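/- Let $m\ge 1$ and let $H^m$ be the Heisenberg group, with underlying manifold $\mathbb{R}^{2m+1}\ni q=(x,y,t)$, $x,y\in\mathbb{R}^m$, $t\in\mathbb{R}$, and left-invariant vector fields $X_j=\partial_{x_j}+2y_j\partial_t$, $Y_j=\partial_{y_j}-2x_j\partial_t$ ($1\le j\le m$). For $C^1$ functions $u,v$ on $H^m$ put $\nabla_{H^m}u\cdot\nabla_{H^m}v=\sum_{j=1}^m (X_ju\,X_jv+Y_ju\,Y_jv)$ and $|\nabla_{H^m}u|=(\nabla_{H^m}u\cdot\nabla_{H^m}u)^{1/2}$. Let $\varphi,f,l:[0,\infty)\to\mathbb{R}$ and constants $D,\Lambda>0$, $\tau\ge 0$ be such that: ($\Phi$) $\varphi\in C^0([0,\infty))\cap C^1((0,\infty))$, $\varphi(0)=0$, and $\varphi'>0$ on $(0,\infty)$; ($F$) $f\in C^0([0,\infty))$, $f>0$ on $(0,\infty)$, and $f$ is non-decreasing on $[0,\infty)$; ($L$) $l\in C^0([0,\infty))$, $l>0$ on $(0,\infty)$, and for some $C\ge 1$, $\sup_{s\in[0,t]}l(s)\le C\,l(t)$ for all $t\ge 0$;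 ($\Phi$ & $L$) $t\varphi'(t)/l(t)$ is integrable near $0^+$ but not integrable near $+\infty$, and $\varphi(t)/l(t)\to 0$ as $t\to 0^+$; ($\Phi 2$) $s\,\varphi'(st)\le D s^{\tau}\varphi'(t)$ for all $s\in(0,1]$, $t>0$; ($L2$) $s^{1+\tau}l(t)\le \Lambda\, l(st)$ for all $s\in[0,1]$, $t\ge 0$. Let $u\in C^1(H^m)$ be a non-negative bounded weak solution of $$\Delta^\varphi_{H^m}u\ \ge\ f(u)\,l(|\nabla_{H^m}u|)\qquad\text{on } H^m,$$ where $\Delta^\varphi_{H^m}u=\sum_{j=1}^m\left[X_j\!\left(\frac{\varphi(|\nabla_{H^m}u|)}{|\nabla_{H^m}u|}X_ju\right)+Y_j\!\left(\frac{\varphi(|\nabla_{H^m}u|)}{|\nabla_{H^m}u|}Y_ju\right)\right]$; that is, for every $\zeta\in C_c^\infty(H^m)$ with $\zeta\ge 0$, $$-\int_{\mathbb{R}^{2m+1}}\frac{\varphi(|\nabla_{H^m}u|)}{|\nabla_{H^m}u|}\,\nabla_{H^m}u\cdot\nabla_{H^m}\zeta\ \ge\ \int_{\mathbb{R}^{2m+1}}f(u)\,l(|\nabla_{H^m}u|)\,\zeta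 ,$$ the first integrand being $0$ where $\nabla_{H^m}u=0$. Then $u$ is constant. Moreover, if $l(0)>0$, then $u\equiv 0$. -/

import Mathlib

open Filter Topology Set MeasureTheory
open scoped ContDiff

noncomputable section

/-- The underlying manifold `ℝ^(2m+1)` of the Heisenberg group `H^m`; a point is
`q = (x, y, t)` with `x, y ∈ ℝ^m` and `t ∈ ℝ`. Its `volume` is Lebesgue measure. -/
abbrev Heis (m : ℕ) : Type := (Fin m → ℝ) × (Fin m → ℝ) × ℝ

namespace Heis

variable {m : ℕ}

/-- The left-invariant vector field `X_j = ∂/∂x_j + 2 y_j ∂/∂t`, applied to `u` at `q`. -/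
def X (j : Fin m) (u : Heis m → ℝ) (q : Heis m) : ℝ :=
  fderiv ℝ u q (Pi.single j 1, 0, 2 * q.2.1 j)

/-- The left-invariant vector field `Y_j = ∂/∂y_j - 2 x_j ∂/∂t`, applied to `u` at `q`. -/
def Y (j : Fin m) (u : Heis m → ℝ) (q : Heis m) : ℝ :=
  fderiv ℝ u q (0, Pi.single j 1, -2 * q.1 j)

/-- The product `∇_H u · ∇_H v` of two horizontal gradients
`∇_H u = ∑ j, (X_j u) X_j + (Y_j u) Y_j`. -/
def gradDot (u v : Heis m → ℝ) (q : Heis m) : ℝ :=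
  ∑ j : Fin m, (X j u q * X j v q + Y j u q * Y j v q)

/-- The length `|∇_H u|` of the horizontal gradient. -/
def gradNorm (u : Heis m → ℝ) (q : Heis m) : ℝ :=
  Real.sqrt (gradDot u u q)

/-- `u` is an entire weak classical solution on `H^m` of the differential inequality
`Δ^φ u ≥ f(u) l(|∇_H u|)`: it is of class `C^1` and, for every non-negative smooth compactly
supported `ζ`,
`- ∫ |∇_H u|⁻¹ φ(|∇_H u|) ∇_H u · ∇_H ζ ≥ ∫ f(u) l(|∇_H u|) ζ`.
At points where `∇_H u = 0` the first integrand is `0`. -/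
def IsWeakSolution (φ f l : ℝ → ℝ) (u : Heis m → ℝ) : Prop :=
  ContDiff ℝ 1 u ∧
    ∀ ζ : Heis m → ℝ, ContDiff ℝ ∞ ζ → HasCompactSupport ζ → (∀ q, 0 ≤ ζ q) →
      -∫ q, (gradNorm u q)⁻¹ * φ (gradNorm u q) * gradDot u ζ q
        ≥ ∫ q, f (u q) * l (gradNorm u q) * ζ q

end Heis

/-- Condition (Φ): `φ ∈ C^0([0,∞)) ∩ C^1((0,∞))`, `φ(0) = 0`, `φ' > 0` on `(0,∞)`. -/
structure CondPhi (φ : ℝ → ℝ) : Prop where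
  continuousOn : ContinuousOn φ (Ici 0)
  contDiffOn : ContDiffOn ℝ 1 φ (Ioi 0)
  map_zero : φ 0 = 0
  deriv_pos : ∀ t, 0 < t → 0 < deriv φ t

/-- Condition (F): `f ∈ C^0([0,∞))`, `f > 0` on `(0,∞)`, `f` increasing (in the wide sense)
on `[0,∞)`. -/
structure CondF (f : ℝ → ℝ) : Prop where
  continuousOn : ContinuousOn f (Ici 0)
  pos : ∀ t, 0 < t → 0 < f t
  monotoneOn : MonotoneOn f (Ici 0)

/-- Condition (L): `l ∈ C^0([0,∞))`, `l > 0` on `(0,∞)`, and `l` is `C`-monotone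
non-decreasing on `[0,∞)` for some `C ≥ 1`: `sup_{[0,t]} l ≤ C l(t)` for all `t ≥ 0`. -/
structure CondL (l : ℝ → ℝ) : Prop where
  continuousOn : ContinuousOn l (Ici 0)
  pos : ∀ t, 0 < t → 0 < l t
  cMonotone : ∃ C : ℝ, 1 ≤ C ∧ ∀ t, 0 ≤ t → ∀ s ∈ Icc 0 t, l s ≤ C * l t

/-- Condition (Φ & L): `t φ'(t) / l(t) ∈ L^1(0+) \ L^1(+∞)` and `φ(t)/l(t) = o(1)` as
`t → 0+`. -/
structure CondPhiL (φ l : ℝ → ℝ) : Prop where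
  integrable_zero : IntegrableAtFilter (fun t => t * deriv φ t / l t) (𝓝[>] 0)
  not_integrable_top : ¬ IntegrableAtFilter (fun t => t * deriv φ t / l t) atTop
  tendsto_zero : Tendsto (fun t => φ t / l t) (𝓝[>] 0) (𝓝 0)

/-- Condition (Φ2): `s φ'(st) ≤ D s^τ φ'(t)` for `s ∈ (0,1]` and `t > 0`. -/
def CondPhi2 (φ : ℝ → ℝ) (D τ : ℝ) : Prop :=
  ∀ s ∈ Ioc (0 : ℝ) 1, ∀ t, 0 < t → s * deriv φ (s * t) ≤ D * s ^ τ * deriv φ t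

/-- Condition (L2): `s^(1+τ) l(t) ≤ Λ l(st)` for `s ∈ [0,1]` and `t ≥ 0`. -/
def CondL2 (l : ℝ → ℝ) (Λ τ : ℝ) : Prop :=
  ∀ s ∈ Icc (0 : ℝ) 1, ∀ t, 0 ≤ t → s ^ (1 + τ) * l t ≤ Λ * l (s * t)

end

/-!
Compare `u` with `c + ε ρ`, where `ρ` is the Korányi distance to a pole near which `u < c`. A weak
solution of class `C^1` satisfies the differential inequality pointwise wherever `w` of class `C^2`
with `∇_H w ≠ 0` touches it from above: otherwise `div_H` of the flux of `w` is too small near the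
touching point, and testing with a bump that is a function of `u - w` contradicts the monotonicity
of `p ↦ φ(|p|) p / |p|`. If `z` denotes the horizontal part of the point relative to the pole, then
`Δ^φ (ε ρ) = φ(ε |z| / ρ) (2m + 1) |z| / ρ²` and `|∇_H (ε ρ)| = ε |z| / ρ ≤ ε`. Since `φ / l → 0`
at `0+`, the function `c + ε ρ` cannot touch `u` from above for small `ε`, so it dominates `u`, and
`ε → 0` gives `u ≤ c`.

The argument fails where `z = 0`, on the vertical line through the pole, since there `∇_H ρ = 0`.
Hence `ρ` is replaced by the minimum of the distances to three poles, chosen so that on the vertical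
line of each of them, away from the pole itself, another one is strictly closer.
-/

section Mollification

open scoped Convolution

variable {E : Type*} [NormedAddCommGroup E] [NormedSpace ℝ E] [MeasurableSpace E]
  {μ : Measure E}

theorem integral_mul_add_fderiv_eq_setIntegral {b ζ : E → ℝ} {V : E → E} {K : Set E}
    (hK : tsupport ζ ⊆ K) :
    ∫ q, (b q * ζ q + fderiv ℝ ζ q (V q)) ∂μ = ∫ q in K, (b q * ζ q + fderiv ℝ ζ q (V q)) ∂μ := by
  refine (setIntegral_eq_integral_of_forall_compl_eq_zero fun q hq => ?_).symm
  have hq' : q ∉ tsupport ζ := fun h => hq (hK h)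
  rw [image_eq_zero_of_notMem_tsupport hq',
    image_eq_zero_of_notMem_tsupport fun h => hq' (tsupport_fderiv_subset ℝ h)]
  simp

variable [BorelSpace E]

theorem integrable_mul_add_fderiv [IsFiniteMeasureOnCompacts μ] {b ζ : E → ℝ} {V : E → E}
    (hb : Continuous b) (hV : Continuous V) (hζ : ContDiff ℝ 1 ζ) (hc : HasCompactSupport ζ) :
    Integrable (fun q => b q * ζ q + fderiv ℝ ζ q (V q)) μ :=
  ((hb.mul hζ.continuous).integrable_of_hasCompactSupport hc.mul_left).add <|
    ((hζ.continuous_fderiv one_ne_zero).clm_apply hV).integrable_of_hasCompactSupport <|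
      (hc.fderiv (𝕜 := ℝ)).mono fun q => by
        contrapose!; simp +contextual

variable [FiniteDimensional ℝ E]

/-- The vector field `q ↦ e + c q • v` is divergence free because `c v = 0`. -/
theorem integral_fderiv_add_smul_eq_zero [μ.IsAddHaarMeasure] {h : E → ℝ} (hh : ContDiff ℝ 1 h)
    (hc : HasCompactSupport h) (e : E) {c : E →L[ℝ] ℝ} {v : E} (hcv : c v = 0) :
    ∫ q, fderiv ℝ h q (e + c q • v) ∂μ = 0 := by
  have hdh : Differentiable ℝ h := hh.differentiable one_ne_zero
  have hint (w : E) (a : E → ℝ) (ha : Continuous a) :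
      Integrable (fun q => a q * fderiv ℝ h q w) μ :=
    (ha.mul <| (hh.continuous_fderiv one_ne_zero).clm_apply
      continuous_const).integrable_of_hasCompactSupport (hc.fderiv_apply (𝕜 := ℝ) w).mul_left
  have h_const : ∫ q, 1 * fderiv ℝ h q e ∂μ = 0 := by
    rw [integral_mul_fderiv_eq_neg_fderiv_mul_of_integrable (by simp)
      (hint e _ continuous_const)
      (by simpa using hh.continuous.integrable_of_hasCompactSupport hc)
      (fun _ _ => by fun_prop) fun q _ => hdh q]
    simp
  have h_lin : ∫ q, c q * fderiv ℝ h q v ∂μ = 0 := by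
    rw [integral_mul_fderiv_eq_neg_fderiv_mul_of_integrable (by simp [hcv])
      (hint v c c.continuous)
      ((c.continuous.mul hh.continuous).integrable_of_hasCompactSupport hc.mul_left)
      (fun _ _ => c.differentiableAt) fun q _ => hdh q]
    simp [hcv]
  calc ∫ q, fderiv ℝ h q (e + c q • v) ∂μ
      = ∫ q, (1 * fderiv ℝ h q e + c q * fderiv ℝ h q v) ∂μ := by simp
    _ = 0 := by
      rw [integral_add (hint e _ continuous_const) (hint v c c.continuous), h_const, h_lin,
        add_zero]

variable [μ.IsAddHaarMeasure]

theorem fderiv_normed_convolution (φ : ContDiffBump (0 : E)) {ζ : E → ℝ} (hζ : ContDiff ℝ 1 ζ)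
    (hc : HasCompactSupport ζ) (q : E) :
    fderiv ℝ (φ.normed μ ⋆[ContinuousLinearMap.lsmul ℝ ℝ, μ] ζ) q =
      (φ.normed μ ⋆[ContinuousLinearMap.lsmul ℝ ℝ, μ] fderiv ℝ ζ) q :=
  (hc.hasFDerivAt_convolution_right (ContinuousLinearMap.lsmul ℝ ℝ)
    φ.continuous_normed.locallyIntegrable hζ q).fderiv

theorem tsupport_normed_convolution_subset (φ : ContDiffBump (0 : E)) (ζ : E → ℝ) :
    tsupport (φ.normed μ ⋆[ContinuousLinearMap.lsmul ℝ ℝ, μ] ζ) ⊆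
      Metric.cthickening φ.rOut (tsupport ζ) := by
  refine closure_minimal ((support_convolution_subset _).trans ?_) Metric.isClosed_cthickening
  rw [φ.support_normed_eq]
  rintro _ ⟨x, hx, y, hy, rfl⟩
  refine Metric.mem_cthickening_of_dist_le _ y _ _ (subset_tsupport _ hy) ?_
  simpa [dist_eq_norm] using (mem_ball_zero_iff.1 hx).le

theorem exists_contDiff_approx_fderiv {ζ : E → ℝ} (hζ : ContDiff ℝ 1 ζ)
    (hc : HasCompactSupport ζ) (h0 : ∀ q, 0 ≤ ζ q) {ε : ℝ} (hε : 0 < ε) :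
    ∃ η : E → ℝ, ContDiff ℝ ∞ η ∧ (∀ q, 0 ≤ η q) ∧
      tsupport η ⊆ Metric.cthickening 1 (tsupport ζ) ∧
      (∀ q, |η q - ζ q| ≤ ε) ∧ ∀ q, ‖fderiv ℝ η q - fderiv ℝ ζ q‖ ≤ ε := by
  let μ : Measure E := Measure.addHaar
  have hdζ : Continuous (fderiv ℝ ζ) := hζ.continuous_fderiv one_ne_zero
  obtain ⟨δ, hδ, hζδ⟩ := Metric.uniformContinuous_iff.1
    (hc.uniformContinuous_of_continuous hζ.continuous) ε hε
  obtain ⟨δ', hδ', hdζδ'⟩ := Metric.uniformContinuous_iff.1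
    ((hc.fderiv (𝕜 := ℝ)).uniformContinuous_of_continuous hdζ) ε hε
  have hr : 0 < min 1 (min δ δ') := lt_min one_pos (lt_min hδ hδ')
  let φ : ContDiffBump (0 : E) := ⟨_, _, half_pos hr, half_lt_self hr⟩
  have hφδ : φ.rOut ≤ δ := (min_le_right _ _).trans (min_le_left _ _)
  have hφδ' : φ.rOut ≤ δ' := (min_le_right _ _).trans (min_le_right _ _)
  refine ⟨φ.normed μ ⋆[ContinuousLinearMap.lsmul ℝ ℝ, μ] ζ, ?_, fun q => ?_, ?_, fun q => ?_,
    fun q => ?_⟩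
  · exact φ.hasCompactSupport_normed.contDiff_convolution_left _ φ.contDiff_normed
      hζ.continuous.locallyIntegrable
  · exact integral_nonneg fun x => mul_nonneg (φ.nonneg_normed x) (h0 _)
  · exact (tsupport_normed_convolution_subset φ ζ).trans
      (Metric.cthickening_mono (min_le_left _ _) _)
  · exact φ.dist_normed_convolution_le hζ.continuous.aestronglyMeasurable
      fun x hx => (hζδ (hx.trans_le hφδ)).le
  · rw [fderiv_normed_convolution φ hζ hc, ← dist_eq_norm]
    exact φ.dist_normed_convolution_le hdζ.aestronglyMeasurable
      fun x hx => (hdζδ' (hx.trans_le hφδ')).le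

theorem integral_mul_add_fderiv_nonpos_of_contDiff_infty {b : E → ℝ} {V : E → E}
    (hb : Continuous b) (hV : Continuous V)
    (h : ∀ ζ : E → ℝ, ContDiff ℝ ∞ ζ → HasCompactSupport ζ → (∀ q, 0 ≤ ζ q) →
      ∫ q, (b q * ζ q + fderiv ℝ ζ q (V q)) ∂μ ≤ 0)
    {ζ : E → ℝ} (hζ : ContDiff ℝ 1 ζ) (hc : HasCompactSupport ζ) (h0 : ∀ q, 0 ≤ ζ q) :
    ∫ q, (b q * ζ q + fderiv ℝ ζ q (V q)) ∂μ ≤ 0 := by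
  let K := Metric.cthickening 1 (tsupport ζ)
  have hK : IsCompact K := hc.isCompact.cthickening
  have hζK : tsupport ζ ⊆ K := Metric.self_subset_cthickening _
  have hbV : IntegrableOn (fun q => |b q| + ‖V q‖) K μ :=
    (hb.abs.add hV.norm).continuousOn.integrableOn_compact hK
  have approx (ε : ℝ) (hε : 0 < ε) :
      ∫ q, (b q * ζ q + fderiv ℝ ζ q (V q)) ∂μ ≤ ε * ∫ q in K, (|b q| + ‖V q‖) ∂μ := by
    obtain ⟨η, hη, hη0, hηK, hηζ, hdηζ⟩ := exists_contDiff_approx_fderiv hζ hc h0 hε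
    have hηc : HasCompactSupport η := hK.of_isClosed_subset (isClosed_tsupport η) hηK
    have hint_η := integrable_mul_add_fderiv (μ := μ) hb hV (hη.of_le (mod_cast le_top)) hηc
    have hint_ζ := integrable_mul_add_fderiv (μ := μ) hb hV hζ hc
    have pointwise (q : E) : b q * ζ q + fderiv ℝ ζ q (V q) ≤
        (b q * η q + fderiv ℝ η q (V q)) + ε * (|b q| + ‖V q‖) := by
      have hb_le : -(b q * (η q - ζ q)) ≤ |b q| * ε := (neg_le_abs _).trans <| by
        rw [abs_mul]; gcongr; exact hηζ q
      have hV_le : -(fderiv ℝ η q - fderiv ℝ ζ q) (V q) ≤ ε * ‖V q‖ :=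
        (neg_le_abs _).trans ((fderiv ℝ η q - fderiv ℝ ζ q).le_of_opNorm_le (hdηζ q) _)
      simp only [sub_apply] at hV_le
      linarith
    calc ∫ q, (b q * ζ q + fderiv ℝ ζ q (V q)) ∂μ
        = ∫ q in K, (b q * ζ q + fderiv ℝ ζ q (V q)) ∂μ :=
          integral_mul_add_fderiv_eq_setIntegral hζK
      _ ≤ ∫ q in K, ((b q * η q + fderiv ℝ η q (V q)) + ε * (|b q| + ‖V q‖)) ∂μ :=
          integral_mono hint_ζ.integrableOn (hint_η.integrableOn.add (hbV.const_mul ε)) pointwise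
      _ = ∫ q, (b q * η q + fderiv ℝ η q (V q)) ∂μ + ε * ∫ q in K, (|b q| + ‖V q‖) ∂μ := by
          rw [integral_add hint_η.integrableOn (hbV.const_mul ε), integral_const_mul,
            ← integral_mul_add_fderiv_eq_setIntegral hηK]
      _ ≤ ε * ∫ q in K, (|b q| + ‖V q‖) ∂μ := add_le_of_nonpos_left (h η hη hηc hη0)
  have hlim : Tendsto (fun ε : ℝ => ε * ∫ q in K, (|b q| + ‖V q‖) ∂μ) (𝓝[>] 0) (𝓝 0) :=
    ((continuous_mul_const _).tendsto' _ _ (zero_mul _)).mono_left nhdsWithin_le_nhds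
  exact ge_of_tendsto hlim (eventually_nhdsWithin_of_forall approx)

end Mollification

section RadialFlux

variable {E : Type*} [NormedAddCommGroup E] [InnerProductSpace ℝ E]

/-- The vector field `p ↦ φ(|p|) p / |p|`, so that `Δ^φ u = div (radialFlux φ (∇u))`; the
convention `0⁻¹ = 0` gives it the value `0` at `p = 0`. -/
noncomputable def radialFlux (φ : ℝ → ℝ) (p : E) : E := (‖p‖⁻¹ * φ ‖p‖) • p

variable {φ : ℝ → ℝ}

theorem norm_radialFlux (hφ0 : φ 0 = 0) (p : E) : ‖radialFlux φ p‖ = |φ ‖p‖| := by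
  rcases eq_or_ne p 0 with rfl | hp
  · simp [radialFlux, hφ0]
  · rw [radialFlux, norm_smul, norm_mul, norm_inv, norm_norm, mul_right_comm,
      inv_mul_cancel₀ (norm_ne_zero_iff.2 hp), one_mul, Real.norm_eq_abs]

theorem inner_radialFlux_self (p : E) : inner ℝ (radialFlux φ p) p = φ ‖p‖ * ‖p‖ := by
  rcases eq_or_ne p 0 with rfl | hp
  · simp
  · have : ‖p‖ ≠ 0 := norm_ne_zero_iff.2 hp
    rw [radialFlux, real_inner_smul_left, real_inner_self_eq_norm_sq]
    field_simp

theorem continuous_radialFlux (hφ : ContinuousOn φ (Ici 0)) (hφ0 : φ 0 = 0) :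
    Continuous (radialFlux φ : E → E) := by
  have hφ_norm : Continuous fun p : E => φ ‖p‖ := hφ.comp_continuous continuous_norm norm_nonneg
  refine continuous_iff_continuousAt.2 fun p => ?_
  rcases eq_or_ne p 0 with rfl | hp
  · rw [ContinuousAt, radialFlux, smul_zero, tendsto_zero_iff_norm_tendsto_zero]
    simpa only [norm_radialFlux hφ0, norm_zero, hφ0, abs_zero] using hφ_norm.abs.tendsto (0 : E)
  · exact ((continuous_norm.continuousAt.inv₀ (norm_ne_zero_iff.2 hp)).mul
      hφ_norm.continuousAt).smul continuousAt_id

theorem contDiffAt_radialFlux {n : WithTop ℕ∞} {p : E} (hφ : ContDiffAt ℝ n φ ‖p‖) (hp : p ≠ 0) :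
    ContDiffAt ℝ n (radialFlux φ : E → E) p :=
  have hnorm : ContDiffAt ℝ n (norm : E → ℝ) p := contDiffAt_norm ℝ hp
  ((hnorm.inv (norm_ne_zero_iff.2 hp)).mul (hφ.comp p hnorm)).smul contDiffAt_id

theorem inner_radialFlux_sub_nonneg (hφ : MonotoneOn φ (Ici 0)) (hφ0 : φ 0 = 0) (p p' : E) :
    0 ≤ inner ℝ (radialFlux φ p - radialFlux φ p') (p - p') := by
  have hφ_nonneg {t : ℝ} (ht : 0 ≤ t) : 0 ≤ φ t := hφ0.symm.trans_le (hφ self_mem_Ici ht ht)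
  have cauchy_schwarz (p p' : E) : inner ℝ (radialFlux φ p) p' ≤ φ ‖p‖ * ‖p'‖ := by
    refine (real_inner_le_norm _ _).trans_eq ?_
    rw [norm_radialFlux hφ0, abs_of_nonneg (hφ_nonneg (norm_nonneg p))]
  calc 0 ≤ (φ ‖p‖ - φ ‖p'‖) * (‖p‖ - ‖p'‖) := by
        rcases le_total ‖p‖ ‖p'‖ with h | h
        · exact mul_nonneg_of_nonpos_of_nonpos
            (sub_nonpos.2 (hφ (norm_nonneg p) (norm_nonneg p') h)) (sub_nonpos.2 h)
        · exact mul_nonneg (sub_nonneg.2 (hφ (norm_nonneg p') (norm_nonneg p) h)) (sub_nonneg.2 h)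
    _ ≤ inner ℝ (radialFlux φ p - radialFlux φ p') (p - p') := by
        simp only [inner_sub_left, inner_sub_right, inner_radialFlux_self]
        linarith [cauchy_schwarz p p', cauchy_schwarz p' p]

end RadialFlux

instance Heis.isAddHaarMeasure_volume (m : ℕ) : (volume : Measure (Heis m)).IsAddHaarMeasure :=
  haveI : (volume : Measure ((Fin m → ℝ) × ℝ)).IsAddHaarMeasure :=
    Measure.prod.instIsAddHaarMeasure _ _
  Measure.prod.instIsAddHaarMeasure _ _

namespace Heis

variable {m : ℕ}

/-- The Euclidean space `ℝ^(2m)` of horizontal coordinates `(x, y)`. It also carries the components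
of horizontal vectors in the frame `X_1, …, X_m, Y_1, …, Y_m`. -/
abbrev HorizSpace (m : ℕ) : Type := EuclideanSpace ℝ (Fin m ⊕ Fin m)

/-- The projection `(x, y, t) ↦ (x, y)`, whose fibres are the vertical lines. -/
noncomputable def horiz : Heis m →L[ℝ] HorizSpace m :=
  LinearMap.toContinuousLinearMap
    { toFun := fun q => WithLp.toLp 2 (Sum.elim q.1 q.2.1)
      map_add' := fun p q => by ext (j | j) <;> rfl
      map_smul' := fun c q => by ext (j | j) <;> rfl }

/-- The quarter turn `(x, y) ↦ (y, -x)`, through which the symplectic form enters the vector fields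
`X_j`, `Y_j` and the group law. -/
noncomputable def rot : HorizSpace m →L[ℝ] HorizSpace m :=
  LinearMap.toContinuousLinearMap
    { toFun := fun z => WithLp.toLp 2 (Sum.elim (fun j => z (.inr j)) fun j => -z (.inl j))
      map_add' := fun z w => by ext (j | j) <;> simp [add_comm]
      map_smul' := fun c z => by ext (j | j) <;> simp }

/-- The horizontal vector `∑ j, (a_j X_j + a_(m+j) Y_j)` at `q`. -/
noncomputable def horizLift (q : Heis m) : HorizSpace m →L[ℝ] Heis m :=
  LinearMap.toContinuousLinearMap
    { toFun := fun a => (fun j => a (.inl j), fun j => a (.inr j), 2 * inner ℝ (rot (horiz q)) a)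
      map_add' := fun a b => by simp [funext_iff, inner_add_right, mul_add]
      map_smul' := fun c a => by simp [funext_iff, real_inner_smul_right, mul_left_comm] }

/-- The horizontal gradient `∇_H u`, in the frame `X_1, …, X_m, Y_1, …, Y_m`. -/
noncomputable def horizGrad (u : Heis m → ℝ) (q : Heis m) : HorizSpace m :=
  (InnerProductSpace.toDual ℝ (HorizSpace m)).symm ((fderiv ℝ u q).comp (horizLift q))

/-- The horizontal divergence `∑ j, (X_j B_j + Y_j B_(m+j))` of a horizontal vector field. -/
noncomputable def horizDiv (B : Heis m → HorizSpace m) (q : Heis m) : ℝ :=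
  ∑ k, fderiv ℝ B q (horizLift q (EuclideanSpace.single k 1)) k

@[simp] theorem horiz_inl (q : Heis m) (j : Fin m) : horiz q (.inl j) = q.1 j := rfl

@[simp] theorem horiz_inr (q : Heis m) (j : Fin m) : horiz q (.inr j) = q.2.1 j := rfl

@[simp] theorem rot_inl (z : HorizSpace m) (j : Fin m) : rot z (.inl j) = z (.inr j) := rfl

@[simp] theorem rot_inr (z : HorizSpace m) (j : Fin m) : rot z (.inr j) = -z (.inl j) := rfl

@[simp] theorem horizLift_vertical (q : Heis m) (a : HorizSpace m) :
    (horizLift q a).2.2 = 2 * inner ℝ (rot (horiz q)) a := rfl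

@[simp] theorem horiz_horizLift (q : Heis m) (a : HorizSpace m) : horiz (horizLift q a) = a := by
  ext (j | j) <;> rfl

theorem horiz_vertical : horiz ((0, 0, 1) : Heis m) = 0 := by
  ext (j | j) <;> rfl

theorem inner_rot_left (z w : HorizSpace m) : inner ℝ (rot z) w = -inner ℝ (rot w) z := by
  simp [PiLp.inner_apply, Fintype.sum_sum_type, mul_comm, add_comm]

@[simp] theorem inner_rot_self (z : HorizSpace m) : inner ℝ (rot z) z = 0 := by
  linarith [inner_rot_left z z]

@[simp] theorem norm_rot (z : HorizSpace m) : ‖rot z‖ = ‖z‖ := by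
  simp [EuclideanSpace.norm_eq, Fintype.sum_sum_type, add_comm]

theorem horizLift_eq_add_smul (q : Heis m) (a : HorizSpace m) :
    horizLift q a = horizLift 0 a + (2 * inner ℝ (rot (horiz q)) a) • ((0, 0, 1) : Heis m) := by
  ext j <;> simp [horizLift]

theorem contDiff_horizLift {n : WithTop ℕ∞} : ContDiff ℝ n (horizLift : Heis m → _) := by
  refine contDiff_clm_apply_iff.2 fun a => ?_
  rw [funext fun q => horizLift_eq_add_smul q a]
  exact contDiff_const.add ((contDiff_const.mul
    ((rot.comp horiz).contDiff.inner ℝ contDiff_const)).smul contDiff_const)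

theorem inner_horizGrad_left (u : Heis m → ℝ) (q : Heis m) (a : HorizSpace m) :
    inner ℝ (horizGrad u q) a = fderiv ℝ u q (horizLift q a) :=
  InnerProductSpace.toDual_symm_apply

theorem inner_horizGrad_right (a : HorizSpace m) (u : Heis m → ℝ) (q : Heis m) :
    inner ℝ a (horizGrad u q) = fderiv ℝ u q (horizLift q a) := by
  rw [real_inner_comm, inner_horizGrad_left]

theorem horizGrad_apply_inl (u : Heis m → ℝ) (q : Heis m) (j : Fin m) :
    horizGrad u q (.inl j) = X j u q := by
  have := inner_horizGrad_right (EuclideanSpace.single (.inl j) 1) u q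
  rw [EuclideanSpace.inner_single_left, map_one, one_mul] at this
  rw [this, X]
  congr 1
  ext i <;> simp [horizLift, Pi.single_apply, EuclideanSpace.inner_single_right]

theorem horizGrad_apply_inr (u : Heis m → ℝ) (q : Heis m) (j : Fin m) :
    horizGrad u q (.inr j) = Y j u q := by
  have := inner_horizGrad_right (EuclideanSpace.single (.inr j) 1) u q
  rw [EuclideanSpace.inner_single_left, map_one, one_mul] at this
  rw [this, Y]
  congr 1
  ext i <;> simp [horizLift, Pi.single_apply, EuclideanSpace.inner_single_right]

theorem gradDot_eq_inner (u v : Heis m → ℝ) (q : Heis m) :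
    gradDot u v q = inner ℝ (horizGrad u q) (horizGrad v q) := by
  simp [gradDot, PiLp.inner_apply, Fintype.sum_sum_type, Finset.sum_add_distrib,
    horizGrad_apply_inl, horizGrad_apply_inr, mul_comm]

theorem gradNorm_eq_norm (u : Heis m → ℝ) (q : Heis m) : gradNorm u q = ‖horizGrad u q‖ := by
  rw [gradNorm, gradDot_eq_inner, real_inner_self_eq_norm_sq, Real.sqrt_sq (norm_nonneg _)]

theorem contDiffAt_horizGrad {u : Heis m → ℝ} {q : Heis m} {n k : WithTop ℕ∞}
    (hu : ContDiffAt ℝ n u q) (hk : k + 1 ≤ n) : ContDiffAt ℝ k (horizGrad u) q :=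
  (InnerProductSpace.toDual ℝ (HorizSpace m)).symm.contDiff.contDiffAt.comp q
    ((hu.fderiv_right hk).clm_comp contDiff_horizLift.contDiffAt)

theorem differentiableAt_horizGrad {u : Heis m → ℝ} {q : Heis m} (hu : ContDiffAt ℝ 2 u q) :
    DifferentiableAt ℝ (horizGrad u) q :=
  (contDiffAt_horizGrad (k := 1) hu (by norm_num)).differentiableAt one_ne_zero

theorem continuous_horizGrad {u : Heis m → ℝ} (hu : ContDiff ℝ 1 u) : Continuous (horizGrad u) :=
  continuous_iff_continuousAt.2 fun _ =>
    (contDiffAt_horizGrad (k := 0) hu.contDiffAt (by simp)).continuousAt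

theorem continuousAt_horizDiv {B : Heis m → HorizSpace m} {q : Heis m}
    (hB : ContDiffAt ℝ 1 B q) : ContinuousAt (horizDiv B) q :=
  tendsto_finsetSum _ fun k _ =>
    ((EuclideanSpace.proj k : HorizSpace m →L[ℝ] ℝ).continuous.continuousAt.comp
      (((hB.fderiv_right (m := 0) (by simp)).clm_apply
        (contDiff_horizLift.contDiffAt.clm_apply contDiffAt_const)).continuousAt))

theorem horizGrad_comp {g : ℝ → ℝ} {g' : ℝ} {v : Heis m → ℝ} {q : Heis m}
    (hg : HasDerivAt g g' (v q)) (hv : DifferentiableAt ℝ v q) :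
    horizGrad (g ∘ v) q = g' • horizGrad v q := by
  refine ext_inner_right ℝ fun a => ?_
  rw [real_inner_smul_left, inner_horizGrad_left, inner_horizGrad_left,
    (hg.comp_hasFDerivAt q hv.hasFDerivAt).fderiv]
  simp

theorem horizGrad_eq_zero {u : Heis m → ℝ} {q : Heis m} (h : fderiv ℝ u q = 0) :
    horizGrad u q = 0 := by
  simp [horizGrad, h]

theorem horizGrad_add {u v : Heis m → ℝ} {q : Heis m} (hu : DifferentiableAt ℝ u q)
    (hv : DifferentiableAt ℝ v q) :
    horizGrad (fun p => u p + v p) q = horizGrad u q + horizGrad v q := by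
  simp [horizGrad, fderiv_fun_add hu hv, ContinuousLinearMap.add_comp]

theorem horizGrad_sub {u v : Heis m → ℝ} {q : Heis m} (hu : DifferentiableAt ℝ u q)
    (hv : DifferentiableAt ℝ v q) :
    horizGrad (fun p => u p - v p) q = horizGrad u q - horizGrad v q := by
  simp [horizGrad, fderiv_fun_sub hu hv, ContinuousLinearMap.sub_comp]

theorem fderiv_horizLift_eq_sum {h : Heis m → ℝ} (q : Heis m) (a : HorizSpace m) :
    fderiv ℝ h q (horizLift q a) =
      ∑ k, fderiv ℝ h q (horizLift q (EuclideanSpace.single k 1)) * a k := by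
  conv_lhs => rw [← (EuclideanSpace.basisFun _ ℝ).sum_repr a]
  simp [map_sum, mul_comm]

theorem horizDiv_smul {a : Heis m → ℝ} {B : Heis m → HorizSpace m} {q : Heis m}
    (ha : DifferentiableAt ℝ a q) (hB : DifferentiableAt ℝ B q) :
    horizDiv (fun p => a p • B p) q = a q * horizDiv B q + inner ℝ (horizGrad a q) (B q) := by
  rw [inner_horizGrad_left, fderiv_horizLift_eq_sum, horizDiv, horizDiv, fderiv_fun_smul ha hB]
  simp only [add_apply, smul_apply, ContinuousLinearMap.smulRight_apply, PiLp.add_apply,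
    PiLp.smul_apply, smul_eq_mul, Finset.sum_add_distrib, Finset.mul_sum]

theorem integral_fderiv_horizLift {h : Heis m → ℝ} (hh : ContDiff ℝ 1 h)
    (hc : HasCompactSupport h) (a : HorizSpace m) : ∫ q, fderiv ℝ h q (horizLift q a) = 0 := by
  refine .trans (integral_congr_ae (.of_forall fun q => ?_)) <|
    integral_fderiv_add_smul_eq_zero (μ := volume) hh hc (horizLift 0 a) (v := (0, 0, 1))
      (c := (2 : ℝ) • (innerSL ℝ a).comp (rot.comp horiz)) (by simp [horiz_vertical])
  simp [horizLift_eq_add_smul q a, real_inner_comm]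

theorem integral_horizDiv {B : Heis m → HorizSpace m} (hB : ContDiff ℝ 1 B)
    (hc : HasCompactSupport B) : ∫ q, horizDiv B q = 0 := by
  have hBk (k) : ContDiff ℝ 1 fun q => B q k := contDiff_euclidean.1 hB k
  have hck (k) : HasCompactSupport fun q => B q k :=
    hc.comp_left (g := fun z : HorizSpace m => z k) rfl
  have hdiv (q) : horizDiv B q =
      ∑ k, fderiv ℝ (fun p => B p k) q (horizLift q (EuclideanSpace.single k 1)) := by
    refine Finset.sum_congr rfl fun k _ => ?_
    have hcoord : HasFDerivAt (fun p => B p k) _ q :=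
      (EuclideanSpace.proj k : HorizSpace m →L[ℝ] ℝ).hasFDerivAt.comp q
        (hB.differentiable one_ne_zero q).hasFDerivAt
    rw [hcoord.fderiv]
    rfl
  have hint (k) : Integrable fun q =>
      fderiv ℝ (fun p => B p k) q (horizLift q (EuclideanSpace.single k 1)) := by
    simpa using integrable_mul_add_fderiv (μ := volume) (b := 0) continuous_const
      ((contDiff_horizLift (n := 0)).continuous.clm_apply continuous_const) (hBk k) (hck k)
  simp only [hdiv]
  rw [integral_finsetSum _ fun k _ => hint k]
  exact Finset.sum_eq_zero fun k _ => integral_fderiv_horizLift (hBk k) (hck k) _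

theorem integrable_horizDiv {B : Heis m → HorizSpace m} (hB : ContDiff ℝ 1 B)
    (hc : HasCompactSupport B) : Integrable (horizDiv B) :=
  (continuous_iff_continuousAt.2 fun _ =>
    continuousAt_horizDiv hB.contDiffAt).integrable_of_hasCompactSupport <|
      (hc.fderiv (𝕜 := ℝ)).mono fun q => by
        contrapose!; simp +contextual [horizDiv]

section Leibniz

variable {u v : Heis m → ℝ} {q : Heis m}

theorem horizGrad_mul (hu : DifferentiableAt ℝ u q) (hv : DifferentiableAt ℝ v q) :
    horizGrad (fun p => u p * v p) q = u q • horizGrad v q + v q • horizGrad u q := by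
  simp [horizGrad, fderiv_fun_mul hu hv, ContinuousLinearMap.add_comp]

theorem horizGrad_pow (hu : DifferentiableAt ℝ u q) (n : ℕ) :
    horizGrad (fun p => u p ^ n) q = (n * u q ^ (n - 1)) • horizGrad u q :=
  horizGrad_comp (g := (· ^ n)) (hasDerivAt_pow n _) hu

theorem horizGrad_inv (hu : DifferentiableAt ℝ u q) (hq : u q ≠ 0) :
    horizGrad (fun p => (u p)⁻¹) q = (-(u q ^ 2)⁻¹) • horizGrad u q :=
  horizGrad_comp (hasDerivAt_inv hq) hu

theorem horizDiv_congr {B C : Heis m → HorizSpace m} (h : B =ᶠ[𝓝 q] C) :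
    horizDiv B q = horizDiv C q := by
  rw [horizDiv, horizDiv, h.fderiv_eq]

theorem horizDiv_add {B C : Heis m → HorizSpace m} (hB : DifferentiableAt ℝ B q)
    (hC : DifferentiableAt ℝ C q) :
    horizDiv (fun p => B p + C p) q = horizDiv B q + horizDiv C q := by
  simp [horizDiv, fderiv_fun_add hB hC, Finset.sum_add_distrib]

theorem horizDiv_horiz : horizDiv horiz q = 2 * m := by
  simp [horizDiv, ContinuousLinearMap.fderiv, two_mul]

theorem horizDiv_rot_horiz : horizDiv (fun p => rot (horiz p)) q = 0 := by
  have hderiv : HasFDerivAt (fun p : Heis m => rot (horiz p)) (rot.comp horiz) q :=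
    (rot.comp horiz).hasFDerivAt
  simp [horizDiv, hderiv.fderiv, Fintype.sum_sum_type]

end Leibniz

end Heis

section Bump

theorem tsupport_indicator_expNegInvGlue_subset {E : Type*} [TopologicalSpace E] {K : Set E}
    (hK : IsClosed K) {v : E → ℝ} (hv : ∀ q ∈ K, ContinuousAt v q)
    (hneg : ∀ q ∈ frontier K, v q < 0) :
    tsupport (K.indicator fun q => expNegInvGlue (v q)) ⊆ interior K := by
  intro q hq
  have hqK : q ∈ K := closure_minimal support_indicator_subset hK hq
  by_contra hqi
  refine notMem_tsupport_iff_eventuallyEq.2 ?_ hq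
  filter_upwards [(hv q hqK).eventually_lt_const (hneg q ⟨subset_closure hqK, hqi⟩)] with p hp
  exact indicator_apply_eq_zero.2 fun _ => expNegInvGlue.zero_of_nonpos hp.le

theorem indicator_expNegInvGlue_eventuallyEq {E : Type*} [TopologicalSpace E] {K : Set E}
    (v : E → ℝ) {q : E} (hq : q ∈ interior K) :
    (K.indicator fun p => expNegInvGlue (v p)) =ᶠ[𝓝 q] expNegInvGlue ∘ v :=
  (eqOn_indicator.mono interior_subset).eventuallyEq_of_mem (isOpen_interior.mem_nhds hq)

variable {E : Type*} [NormedAddCommGroup E] [NormedSpace ℝ E]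

theorem contDiff_of_forall_mem_tsupport {F : Type*} [NormedAddCommGroup F] [NormedSpace ℝ F]
    {n : WithTop ℕ∞} {f : E → F} (h : ∀ q ∈ tsupport f, ContDiffAt ℝ n f q) : ContDiff ℝ n f :=
  contMDiff_iff_contDiff.1 (contMDiff_of_tsupport fun q hq => (h q hq).contMDiffAt)

theorem contDiff_indicator_expNegInvGlue {n : ℕ∞} {K : Set E} (hK : IsClosed K)
    {v : E → ℝ} (hv : ∀ q ∈ K, ContDiffAt ℝ n v q) (hneg : ∀ q ∈ frontier K, v q < 0) :
    ContDiff ℝ n (K.indicator fun q => expNegInvGlue (v q)) := by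
  refine contDiff_of_forall_mem_tsupport fun q hq => ?_
  have hqi : q ∈ interior K :=
    tsupport_indicator_expNegInvGlue_subset hK (fun q hq => (hv q hq).continuousAt) hneg hq
  exact (expNegInvGlue.contDiff.contDiffAt.comp q
    (hv q (interior_subset hqi))).congr_of_eventuallyEq (indicator_expNegInvGlue_eventuallyEq v hqi)

theorem fderiv_indicator_expNegInvGlue {K : Set E} {v : E → ℝ} {q : E} (hq : q ∈ interior K)
    (hv : DifferentiableAt ℝ v q) :
    fderiv ℝ (K.indicator fun p => expNegInvGlue (v p)) q =
      deriv expNegInvGlue (v q) • fderiv ℝ v q := by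
  have hglue : HasDerivAt expNegInvGlue (deriv expNegInvGlue (v q)) (v q) :=
    (expNegInvGlue.contDiff.differentiable one_ne_zero _).hasDerivAt
  rw [(indicator_expNegInvGlue_eventuallyEq v hq).fderiv_eq,
    (hglue.comp_hasFDerivAt q hv.hasFDerivAt).fderiv]

theorem exists_bump_of_strict_localMax [ProperSpace E] {v : E → ℝ} {q₀ : E} {U : Set E}
    (hU : U ∈ 𝓝 q₀) (hv : ContDiffAt ℝ 1 v q₀) (hmax : ∀ᶠ q in 𝓝 q₀, q ≠ q₀ → v q < v q₀) :
    ∃ ζ : E → ℝ, ContDiff ℝ 1 ζ ∧ HasCompactSupport ζ ∧ (∀ q, 0 ≤ ζ q) ∧ ζ q₀ ≠ 0 ∧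
      tsupport ζ ⊆ U ∧ ∀ q ∈ tsupport ζ, ∃ c : ℝ, 0 ≤ c ∧ fderiv ℝ ζ q = c • fderiv ℝ v q := by
  obtain ⟨r, hr, hball⟩ := Metric.nhds_basis_closedBall.eventually_iff.1
    ((eventually_mem_set.2 hU).and ((hv.eventually (by simp)).and hmax))
  obtain ⟨δ, hδ, hgap⟩ : ∃ δ, 0 < δ ∧ ∀ q ∈ Metric.sphere q₀ r, δ ≤ v q₀ - v q := by
    refine (isCompact_sphere q₀ r).exists_forall_le' (fun q hq => ?_) fun q hq => ?_
    · exact (continuousAt_const.sub (hball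
        (Metric.sphere_subset_closedBall hq)).2.1.continuousAt).continuousWithinAt
    · exact sub_pos.2 ((hball (Metric.sphere_subset_closedBall hq)).2.2
        (Metric.ne_of_mem_sphere hq hr.ne'))
  let K := Metric.closedBall q₀ r
  -- cut `v` off at a level strictly between its values on the sphere and at the centre
  let v' : E → ℝ := fun q => v q - (v q₀ - δ / 2)
  have hv' (q) (hq : q ∈ K) : ContDiffAt ℝ 1 v' q := (hball hq).2.1.sub contDiffAt_const
  have hneg (q) (hq : q ∈ frontier K) : v' q < 0 := by
    have := hgap q (Metric.frontier_closedBall_subset_sphere hq)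
    simp only [v']
    linarith
  have hsupp := tsupport_indicator_expNegInvGlue_subset Metric.isClosed_closedBall
    (fun q hq => (hv' q hq).continuousAt) hneg
  refine ⟨K.indicator fun q => expNegInvGlue (v' q),
    contDiff_indicator_expNegInvGlue Metric.isClosed_closedBall hv' hneg,
    (isCompact_closedBall q₀ r).of_isClosed_subset (isClosed_tsupport _)
      (hsupp.trans interior_subset),
    indicator_nonneg fun _ _ => expNegInvGlue.nonneg _, ?_,
    fun q hq => (hball (interior_subset (hsupp hq))).1,
    fun q hq => ⟨deriv expNegInvGlue (v' q), expNegInvGlue.monotone.deriv_nonneg, ?_⟩⟩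
  · rw [indicator_of_mem (Metric.mem_closedBall_self hr.le)]
    exact (expNegInvGlue.pos_of_pos (by simp only [v']; linarith)).ne'
  · rw [fderiv_indicator_expNegInvGlue (hsupp hq)
      ((hv' q (interior_subset (hsupp hq))).differentiableAt one_ne_zero), fderiv_sub_const]

end Bump

namespace Heis

variable {m : ℕ}

section WeakDivGe

variable {V B : Heis m → HorizSpace m} {b ζ u w : Heis m → ℝ} {q₀ : Heis m} {φ f l : ℝ → ℝ}

/-- The differential inequality `div_H V ≥ b` in the weak sense, for a horizontal vector field `V`;
it has this meaning when `V` and `b` are continuous, so that the integrals exist. -/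
def WeakDivGe (V : Heis m → HorizSpace m) (b : Heis m → ℝ) : Prop :=
  ∀ ζ : Heis m → ℝ, ContDiff ℝ ∞ ζ → HasCompactSupport ζ → (∀ q, 0 ≤ ζ q) →
    ∫ q, (b q * ζ q + inner ℝ (V q) (horizGrad ζ q)) ≤ 0

theorem integrable_mul_add_inner_horizGrad (hb : Continuous b) (hV : Continuous V)
    (hζ : ContDiff ℝ 1 ζ) (hc : HasCompactSupport ζ) :
    Integrable fun q => b q * ζ q + inner ℝ (V q) (horizGrad ζ q) := by
  simp only [inner_horizGrad_right]
  exact integrable_mul_add_fderiv hb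
    ((contDiff_horizLift (n := 0)).continuous.clm_apply hV) hζ hc

theorem WeakDivGe.integral_nonpos (h : WeakDivGe V b) (hb : Continuous b) (hV : Continuous V)
    (hζ : ContDiff ℝ 1 ζ) (hc : HasCompactSupport ζ) (h0 : ∀ q, 0 ≤ ζ q) :
    ∫ q, (b q * ζ q + inner ℝ (V q) (horizGrad ζ q)) ≤ 0 := by
  simp only [WeakDivGe, inner_horizGrad_right] at h ⊢
  exact integral_mul_add_fderiv_nonpos_of_contDiff_infty hb
    ((contDiff_horizLift (n := 0)).continuous.clm_apply hV) h hζ hc h0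

theorem continuous_comp_mul_comp_norm_horizGrad (hf : ContinuousOn f (Ici 0))
    (hl : ContinuousOn l (Ici 0)) (hu : ContDiff ℝ 1 u) (hu0 : ∀ q, 0 ≤ u q) :
    Continuous fun q => f (u q) * l ‖horizGrad u q‖ :=
  (hf.comp_continuous hu.continuous hu0).mul
    (hl.comp_continuous (continuous_horizGrad hu).norm fun _ => norm_nonneg _)

theorem IsWeakSolution.weakDivGe (hφ : ContinuousOn φ (Ici 0)) (hφ0 : φ 0 = 0)
    (hf : ContinuousOn f (Ici 0)) (hl : ContinuousOn l (Ici 0)) (hu : IsWeakSolution φ f l u)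
    (hu0 : ∀ q, 0 ≤ u q) :
    WeakDivGe (radialFlux φ ∘ horizGrad u) fun q => f (u q) * l ‖horizGrad u q‖ := by
  intro ζ hζ hc h0
  have hζ1 : ContDiff ℝ 1 ζ := hζ.of_le (mod_cast le_top)
  have hint_absorption : Integrable fun q => f (u q) * l ‖horizGrad u q‖ * ζ q := by
    simpa using integrable_mul_add_inner_horizGrad (V := 0)
      (continuous_comp_mul_comp_norm_horizGrad hf hl hu.1 hu0) continuous_const hζ1 hc
  have hint_flux : Integrable fun q =>
      inner ℝ ((radialFlux φ ∘ horizGrad u) q) (horizGrad ζ q) := by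
    simpa using integrable_mul_add_inner_horizGrad (b := 0) continuous_const
      ((continuous_radialFlux hφ hφ0).comp (continuous_horizGrad hu.1)) hζ1 hc
  rw [integral_add hint_absorption hint_flux]
  have hweak := hu.2 ζ hζ hc h0
  simp only [gradDot_eq_inner, gradNorm_eq_norm, ← real_inner_smul_left] at hweak
  exact le_neg_iff_add_nonpos_right.1 hweak

theorem horizDiv_smul_of_contDiffAt_tsupport (hζ : ContDiff ℝ 1 ζ)
    (hB : ∀ q ∈ tsupport ζ, ContDiffAt ℝ 1 B q) (q : Heis m) :
    horizDiv (fun p => ζ p • B p) q = ζ q * horizDiv B q + inner ℝ (horizGrad ζ q) (B q) := by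
  by_cases hq : q ∈ tsupport ζ
  · exact horizDiv_smul (hζ.differentiable one_ne_zero q) ((hB q hq).differentiableAt one_ne_zero)
  · have hζ_zero : ζ =ᶠ[𝓝 q] 0 := notMem_tsupport_iff_eventuallyEq.1 hq
    have hζB_zero : (fun p => ζ p • B p) =ᶠ[𝓝 q] 0 := hζ_zero.mono fun p hp => by simp [hp]
    simp [horizDiv, horizGrad, hζB_zero.fderiv_eq, hζ_zero.fderiv_eq, hζ_zero.eq_of_nhds]

theorem WeakDivGe.exists_le_horizDiv (h : WeakDivGe V b) (hb : Continuous b) (hV : Continuous V)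
    (hζ : ContDiff ℝ 1 ζ) (hc : HasCompactSupport ζ) (h0 : ∀ q, 0 ≤ ζ q) (hq₀ : ζ q₀ ≠ 0)
    (hB : ∀ q ∈ tsupport ζ, ContDiffAt ℝ 1 B q)
    (hVB : ∀ q ∈ tsupport ζ, 0 ≤ inner ℝ (V q - B q) (horizGrad ζ q)) :
    ∃ q ∈ tsupport ζ, b q ≤ horizDiv B q := by
  by_contra! hlt
  have hζB : ContDiff ℝ 1 fun q => ζ q • B q := contDiff_of_forall_mem_tsupport fun q hq =>
    hζ.contDiffAt.smul (hB q (tsupport_smul_subset_left ζ B hq))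
  have hζB_supp : HasCompactSupport fun q => ζ q • B q := hc.smul_right
  let F : Heis m → ℝ := fun q =>
    b q * ζ q + inner ℝ (V q) (horizGrad ζ q) - horizDiv (fun p => ζ p • B p) q
  have hF (q) : F q = (b q - horizDiv B q) * ζ q + inner ℝ (V q - B q) (horizGrad ζ q) := by
    simp only [F, horizDiv_smul_of_contDiffAt_tsupport hζ hB, inner_sub_left,
      real_inner_comm (B q)]
    ring
  have hF_ge (q) : 0 ≤ F q ∧ (ζ q ≠ 0 → 0 < F q) := by
    rw [hF]
    by_cases hq : q ∈ tsupport ζ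
    · have hgap := sub_pos.2 (hlt q hq)
      exact ⟨add_nonneg (mul_nonneg hgap.le (h0 q)) (hVB q hq), fun hne =>
        add_pos_of_pos_of_nonneg (mul_pos hgap ((h0 q).lt_of_ne' hne)) (hVB q hq)⟩
    · have hζ_zero : ζ =ᶠ[𝓝 q] 0 := notMem_tsupport_iff_eventuallyEq.1 hq
      simp [horizGrad, hζ_zero.fderiv_eq, hζ_zero.eq_of_nhds]
  have hint := integrable_mul_add_inner_horizGrad hb hV hζ hc
  have hF_pos : 0 < ∫ q, F q := by
    rw [integral_pos_iff_support_of_nonneg (fun q => (hF_ge q).1)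
      (hint.sub (integrable_horizDiv hζB hζB_supp))]
    exact (hζ.continuous.isOpen_support.measure_pos volume ⟨q₀, hq₀⟩).trans_le
      (measure_mono fun q hq => ((hF_ge q).2 hq).ne')
  have hF_int : ∫ q, F q = ∫ q, (b q * ζ q + inner ℝ (V q) (horizGrad ζ q)) := by
    rw [integral_sub hint (integrable_horizDiv hζB hζB_supp), integral_horizDiv hζB hζB_supp,
      sub_zero]
  exact hF_pos.not_ge (hF_int.trans_le (h.integral_nonpos hb hV hζ hc h0))

theorem WeakDivGe.le_horizDiv_of_strict_localMax {A : HorizSpace m → HorizSpace m}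
    (h : WeakDivGe (A ∘ horizGrad u) b) (hb : Continuous b) (hA : Continuous A)
    (hA_mono : ∀ p p', 0 ≤ inner ℝ (A p - A p') (p - p')) (hu : ContDiff ℝ 1 u)
    (hw : ContDiffAt ℝ 2 w q₀) (hA₁ : ContDiffAt ℝ 1 A (horizGrad w q₀))
    (hmax : ∀ᶠ q in 𝓝 q₀, q ≠ q₀ → u q - w q < u q₀ - w q₀) :
    b q₀ ≤ horizDiv (A ∘ horizGrad w) q₀ := by
  by_contra! hlt
  have hB : ContDiffAt ℝ 1 (A ∘ horizGrad w) q₀ :=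
    hA₁.comp q₀ (contDiffAt_horizGrad hw (by norm_num))
  have hU : ∀ᶠ q in 𝓝 q₀, ContDiffAt ℝ 1 w q ∧ ContDiffAt ℝ 1 (A ∘ horizGrad w) q ∧
      horizDiv (A ∘ horizGrad w) q < b q :=
    ((hw.of_le one_le_two).eventually (by simp)).and <| (hB.eventually (by simp)).and <|
      (continuousAt_horizDiv hB).eventually_lt hb.continuousAt hlt
  obtain ⟨ζ, hζ, hc, h0, hq₀, hsupp, hderiv⟩ := exists_bump_of_strict_localMax hU
    (hu.contDiffAt.sub (hw.of_le one_le_two)) hmax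
  obtain ⟨q, hq, hle⟩ := h.exists_le_horizDiv hb (hA.comp (continuous_horizGrad hu)) hζ hc h0 hq₀
    (fun q hq => (hsupp hq).2.1) fun q hq => by
      obtain ⟨c, hc, hζ_deriv⟩ := hderiv q hq
      have hgrad : horizGrad ζ q = c • (horizGrad u q - horizGrad w q) := by
        rw [← horizGrad_sub (hu.differentiable one_ne_zero q)
          ((hsupp hq).1.differentiableAt one_ne_zero), horizGrad, hζ_deriv]
        simp [horizGrad]
      rw [hgrad, real_inner_smul_right]
      exact mul_nonneg hc (hA_mono _ _)
  exact hle.not_gt (hsupp hq).2.2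

theorem exists_contDiff_pos_horizGrad_flat (q₀ : Heis m) :
    ∃ Q : Heis m → ℝ, ContDiff ℝ 2 Q ∧ Q q₀ = 0 ∧ (∀ q ≠ q₀, 0 < Q q) ∧
      horizGrad Q q₀ = 0 ∧ HasFDerivAt (horizGrad Q) (0 : Heis m →L[ℝ] HorizSpace m) q₀ := by
  let R : Heis m → ℝ := fun q => ‖toEuclidean (q - q₀)‖ ^ 2
  have hR : ContDiff ℝ 2 R :=
    (toEuclidean.contDiff.comp (contDiff_id.sub contDiff_const)).norm_sq ℝ
  have hR₀ : R q₀ = 0 := by simp [R]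
  have hR_grad : horizGrad R q₀ = 0 :=
    horizGrad_eq_zero (IsLocalMin.fderiv_eq_zero (.of_forall fun q => by simp [R]))
  have hQ_grad : horizGrad (fun q => R q ^ 2) = fun q => (2 * R q) • horizGrad R q := by
    funext q
    simp [horizGrad_pow (hR.differentiable two_ne_zero q)]
  refine ⟨fun q => R q ^ 2, hR.pow 2, by simp [hR₀], fun q hq => ?_, by simp [hQ_grad, hR₀], ?_⟩
  · have : toEuclidean (q - q₀) ≠ 0 := by simpa [sub_eq_zero] using hq
    simp only [R]
    positivity
  · rw [hQ_grad]
    have hcoeff := (hR.differentiable two_ne_zero q₀).hasFDerivAt.const_mul 2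
    have hgrad := (differentiableAt_horizGrad (hR.contDiffAt (x := q₀))).hasFDerivAt
    simpa [hR₀, hR_grad] using hcoeff.fun_smul hgrad

theorem WeakDivGe.le_horizDiv_of_localMax {A : HorizSpace m → HorizSpace m}
    (h : WeakDivGe (A ∘ horizGrad u) b) (hb : Continuous b) (hA : Continuous A)
    (hA_mono : ∀ p p', 0 ≤ inner ℝ (A p - A p') (p - p')) (hu : ContDiff ℝ 1 u)
    (hw : ContDiffAt ℝ 2 w q₀) (hA₁ : ContDiffAt ℝ 1 A (horizGrad w q₀))
    (hmax : IsLocalMax (fun q => u q - w q) q₀) :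
    b q₀ ≤ horizDiv (A ∘ horizGrad w) q₀ := by
  obtain ⟨Q, hQ, hQ₀, hQ_pos, hQ_grad, hQ_deriv⟩ := exists_contDiff_pos_horizGrad_flat q₀
  have hgrad : horizGrad (fun q => w q + Q q) =ᶠ[𝓝 q₀] fun q => horizGrad w q + horizGrad Q q := by
    filter_upwards [(hw.of_le one_le_two).eventually (by simp)] with q hq
    exact horizGrad_add (hq.differentiableAt one_ne_zero) (hQ.differentiable two_ne_zero q)
  have hgrad₀ : horizGrad (fun q => w q + Q q) q₀ = horizGrad w q₀ := by
    rw [hgrad.eq_of_nhds, hQ_grad, add_zero]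
  have hA_deriv : HasFDerivAt A (fderiv ℝ A (horizGrad w q₀)) (horizGrad w q₀) :=
    (hA₁.differentiableAt one_ne_zero).hasFDerivAt
  have hw_deriv := (differentiableAt_horizGrad hw).hasFDerivAt
  have hwQ_deriv := (hw_deriv.add hQ_deriv).congr_of_eventuallyEq hgrad
  rw [add_zero] at hwQ_deriv
  have hdiv : horizDiv (A ∘ horizGrad fun q => w q + Q q) q₀ = horizDiv (A ∘ horizGrad w) q₀ := by
    rw [horizDiv, horizDiv, (hA_deriv.comp q₀ hw_deriv).fderiv,
      (HasFDerivAt.comp q₀ (hgrad₀ ▸ hA_deriv) hwQ_deriv).fderiv, hgrad₀]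
  rw [← hdiv]
  refine h.le_horizDiv_of_strict_localMax hb hA hA_mono hu (hw.add hQ.contDiffAt)
    (hgrad₀.symm ▸ hA₁) ?_
  filter_upwards [hmax] with q hq hne
  linarith [hQ_pos q hne]

theorem IsWeakSolution.le_horizDiv_of_localMax (hφ : ContinuousOn φ (Ici 0))
    (hφ_mono : MonotoneOn φ (Ici 0)) (hφ0 : φ 0 = 0) (hf : ContinuousOn f (Ici 0))
    (hl : ContinuousOn l (Ici 0)) (hu : IsWeakSolution φ f l u) (hu0 : ∀ q, 0 ≤ u q)
    (hw : ContDiffAt ℝ 2 w q₀) (hφ₁ : ContDiffAt ℝ 1 φ ‖horizGrad w q₀‖)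
    (hw_grad : horizGrad w q₀ ≠ 0) (hmax : IsLocalMax (fun q => u q - w q) q₀) :
    f (u q₀) * l ‖horizGrad w q₀‖ ≤ horizDiv (radialFlux φ ∘ horizGrad w) q₀ := by
  have hgrad : horizGrad u q₀ = horizGrad w q₀ := by
    rw [← sub_eq_zero, ← horizGrad_sub (hu.1.differentiable one_ne_zero q₀)
      (hw.differentiableAt two_ne_zero), horizGrad_eq_zero hmax.fderiv_eq_zero]
  rw [← hgrad]
  exact (hu.weakDivGe hφ hφ0 hf hl hu0).le_horizDiv_of_localMax
    (continuous_comp_mul_comp_norm_horizGrad hf hl hu.1 hu0) (continuous_radialFlux hφ hφ0)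
    (inner_radialFlux_sub_nonneg hφ_mono hφ0) hu.1 hw (contDiffAt_radialFlux hφ₁ hw_grad) hmax

end WeakDivGe

section Group

/-- The group law of `H^m`, with neutral element `0` and inverse `-q`; the fields `X_j` and `Y_j`
are invariant under its left translations `mul h`. -/
noncomputable def mul (h q : Heis m) : Heis m :=
  h + q + (2 * inner ℝ (rot (horiz h)) (horiz q)) • (0, 0, 1)

@[simp] theorem horiz_mul (h q : Heis m) : horiz (mul h q) = horiz h + horiz q := by
  rw [mul, map_add, map_add, map_smul, horiz_vertical, smul_zero, add_zero]

protected theorem mul_assoc (p q r : Heis m) : mul (mul p q) r = mul p (mul q r) := by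
  rw [mul, horiz_mul, mul, mul, horiz_mul, mul, map_add, inner_add_left, inner_add_right]
  module

theorem neg_mul_cancel (q : Heis m) : mul (-q) q = 0 := by
  simp [mul]

theorem neg_mul_rev (p q : Heis m) : -mul p q = mul (-q) (-p) := by
  rw [mul, mul, map_neg, map_neg, map_neg, inner_neg_neg, inner_rot_left (horiz p)]
  module

protected theorem zero_mul (q : Heis m) : mul 0 q = q := by
  simp [mul]

theorem neg_mul_cancel_left (p q : Heis m) : mul (-p) (mul p q) = q := by
  rw [← Heis.mul_assoc, neg_mul_cancel, Heis.zero_mul]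

theorem mul_neg_cancel_left (p q : Heis m) : mul p (mul (-p) q) = q := by
  simpa using neg_mul_cancel_left (-p) q

theorem neg_mul_mul_left (g p q : Heis m) : mul (-mul g p) (mul g q) = mul (-p) q := by
  rw [neg_mul_rev, Heis.mul_assoc, neg_mul_cancel_left]

theorem contDiff_mul (h : Heis m) {n : WithTop ℕ∞} : ContDiff ℝ n (mul h) :=
  (contDiff_const.add contDiff_id).add
    ((contDiff_const.mul (contDiff_const.inner ℝ horiz.contDiff)).smul contDiff_const)

/-- The left translation `q ↦ h q`. -/
noncomputable def mulHomeomorph (h : Heis m) : Heis m ≃ₜ Heis m where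
  toFun := mul h
  invFun := mul (-h)
  left_inv := neg_mul_cancel_left h
  right_inv := mul_neg_cancel_left h
  continuous_toFun := (contDiff_mul h (n := 0)).continuous
  continuous_invFun := (contDiff_mul (-h) (n := 0)).continuous

theorem fderiv_mul_horizLift (h q : Heis m) (a : HorizSpace m) :
    fderiv ℝ (mul h) q (horizLift q a) = horizLift (mul h q) a := by
  have hderiv : HasFDerivAt (mul h) (ContinuousLinearMap.id ℝ (Heis m) +
      ((2 : ℝ) • (innerSL ℝ (rot (horiz h))).comp horiz).smulRight ((0, 0, 1) : Heis m)) q :=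
    ((hasFDerivAt_id q).const_add h).add
      (((2 : ℝ) • (innerSL ℝ (rot (horiz h))).comp horiz).smulRight
        ((0, 0, 1) : Heis m)).hasFDerivAt
  rw [hderiv.fderiv, horizLift_eq_add_smul (mul h q), horizLift_eq_add_smul q, horiz_mul,
    map_add rot, inner_add_left]
  simp only [add_apply, ContinuousLinearMap.id_apply, ContinuousLinearMap.smulRight_apply,
    smul_apply, ContinuousLinearMap.comp_apply, innerSL_apply_apply, map_add, map_smul,
    horiz_horizLift, horiz_vertical, inner_zero_right, smul_eq_mul]
  module

theorem fderiv_comp_mul_horizLift {F : Type*} [NormedAddCommGroup F] [NormedSpace ℝ F]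
    (h : Heis m) (B : Heis m → F) (q : Heis m) (a : HorizSpace m) :
    fderiv ℝ (B ∘ mul h) q (horizLift q a) = fderiv ℝ B (mul h q) (horizLift (mul h q) a) := by
  have hmul (g p : Heis m) : DifferentiableAt ℝ (mul g) p :=
    (contDiff_mul (n := 1) g).differentiable one_ne_zero p
  by_cases hB : DifferentiableAt ℝ B (mul h q)
  · rw [fderiv_comp q hB (hmul h q), ContinuousLinearMap.comp_apply, fderiv_mul_horizLift]
  · have hB' : ¬DifferentiableAt ℝ (B ∘ mul h) q := fun hdiff => hB <| by
      rw [← neg_mul_cancel_left h q] at hdiff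
      simpa [Function.comp_def, mul_neg_cancel_left] using hdiff.comp (mul h q) (hmul (-h) _)
    simp [fderiv_zero_of_not_differentiableAt, hB, hB']

theorem horizGrad_comp_mul (h : Heis m) (u : Heis m → ℝ) :
    horizGrad (u ∘ mul h) = horizGrad u ∘ mul h :=
  funext fun q => ext_inner_right ℝ fun a => by
    rw [inner_horizGrad_left, fderiv_comp_mul_horizLift, Function.comp_apply, inner_horizGrad_left]

theorem horizDiv_comp_mul (h : Heis m) (B : Heis m → HorizSpace m) :
    horizDiv (B ∘ mul h) = horizDiv B ∘ mul h :=
  funext fun q => Finset.sum_congr rfl fun k _ => by rw [fderiv_comp_mul_horizLift]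

end Group

section Gauge

variable {q : Heis m}

/-- The Korányi gauge `(|z|⁴ + t²)^(1/4)` of the point `(z, t)`, `z ∈ ℝ^(2m)`. -/
noncomputable def koranyiNorm (q : Heis m) : ℝ := (‖horiz q‖ ^ 4 + q.2.2 ^ 2) ^ (1 / 4 : ℝ)

/-- The horizontal field `|z|² z + t Jz`, where `z = (x, y)` and `J = rot`: the horizontal gradient
of a quarter of the fourth power of the Korányi gauge, hence polynomial. -/
noncomputable def koranyiField (q : Heis m) : HorizSpace m :=
  ‖horiz q‖ ^ 2 • horiz q + q.2.2 • rot (horiz q)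

theorem koranyiNorm_nonneg (q : Heis m) : 0 ≤ koranyiNorm q :=
  Real.rpow_nonneg (by positivity) _

theorem koranyiNorm_pow_four (q : Heis m) : koranyiNorm q ^ 4 = ‖horiz q‖ ^ 4 + q.2.2 ^ 2 := by
  rw [koranyiNorm, ← Real.rpow_mul_natCast (by positivity)]
  norm_num

theorem norm_horiz_le_koranyiNorm (q : Heis m) : ‖horiz q‖ ≤ koranyiNorm q := by
  refine le_of_pow_le_pow_left₀ four_ne_zero (koranyiNorm_nonneg q) ?_
  rw [koranyiNorm_pow_four]
  exact le_add_of_nonneg_right (sq_nonneg _)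

theorem abs_vertical_le_koranyiNorm_sq (q : Heis m) : |q.2.2| ≤ koranyiNorm q ^ 2 := by
  refine abs_le_of_sq_le_sq ?_ (sq_nonneg _)
  rw [← pow_mul, koranyiNorm_pow_four]
  exact le_add_of_nonneg_left (by positivity)

theorem norm_le_koranyiNorm_add_sq (q : Heis m) : ‖q‖ ≤ koranyiNorm q + koranyiNorm q ^ 2 := by
  have hρ := koranyiNorm_nonneg q
  have hcoord (k) : ‖horiz q k‖ ≤ koranyiNorm q + koranyiNorm q ^ 2 :=
    (PiLp.norm_apply_le (horiz q) k).trans <|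
      (norm_horiz_le_koranyiNorm q).trans (le_add_of_nonneg_right (sq_nonneg _))
  refine norm_prod_le_iff.2 ⟨?_, norm_prod_le_iff.2 ⟨?_, ?_⟩⟩
  · exact (pi_norm_le_iff_of_nonneg (by positivity)).2 fun j => hcoord (.inl j)
  · exact (pi_norm_le_iff_of_nonneg (by positivity)).2 fun j => hcoord (.inr j)
  · exact (abs_vertical_le_koranyiNorm_sq q).trans (le_add_of_nonneg_left hρ)

theorem koranyiNorm_pos (hq : q ≠ 0) : 0 < koranyiNorm q := by
  refine (koranyiNorm_nonneg q).lt_of_ne' fun h => hq (norm_le_zero_iff.1 ?_)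
  simpa [h] using norm_le_koranyiNorm_add_sq q

theorem contDiffAt_koranyiNorm {n : WithTop ℕ∞} (hq : q ≠ 0) : ContDiffAt ℝ n koranyiNorm q := by
  have hquartic : ContDiff ℝ n fun q : Heis m => (‖horiz q‖ ^ 2) ^ 2 + q.2.2 ^ 2 :=
    ((horiz.contDiff.norm_sq ℝ).pow 2).add (contDiff_snd.snd.pow 2)
  simp only [← pow_mul] at hquartic
  refine hquartic.contDiffAt.rpow_const_of_ne ?_
  exact ((koranyiNorm_pow_four q).symm.trans_ne (pow_pos (koranyiNorm_pos hq) 4).ne')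

theorem horizGrad_vertical (q : Heis m) :
    horizGrad (fun p => p.2.2) q = (2 : ℝ) • rot (horiz q) := by
  refine ext_inner_right ℝ fun a => ?_
  let vertical : Heis m →L[ℝ] ℝ :=
    (ContinuousLinearMap.snd ℝ _ _).comp (ContinuousLinearMap.snd ℝ _ _)
  have hderiv : HasFDerivAt (fun p : Heis m => p.2.2) vertical q := vertical.hasFDerivAt
  rw [inner_horizGrad_left, hderiv.fderiv, real_inner_smul_left]
  exact horizLift_vertical q a

theorem horizGrad_norm_horiz_sq (q : Heis m) :
    horizGrad (fun p => ‖horiz p‖ ^ 2) q = (2 : ℝ) • horiz q := by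
  refine ext_inner_right ℝ fun a => ?_
  rw [inner_horizGrad_left, (horiz.hasFDerivAt.norm_sq (x := q)).fderiv, real_inner_smul_left]
  simp

theorem horizGrad_koranyiNorm_pow_four (q : Heis m) :
    horizGrad (fun p => koranyiNorm p ^ 4) q = (4 : ℝ) • koranyiField q := by
  have hz : DifferentiableAt ℝ (fun p : Heis m => ‖horiz p‖ ^ 2) q :=
    horiz.differentiableAt.norm_sq ℝ
  have ht : DifferentiableAt ℝ (fun p : Heis m => p.2.2) q := by fun_prop
  have hquartic : (fun p : Heis m => koranyiNorm p ^ 4) =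
      fun p => (‖horiz p‖ ^ 2) ^ 2 + p.2.2 ^ 2 :=
    funext fun p => by rw [koranyiNorm_pow_four, ← pow_mul]
  rw [hquartic, horizGrad_add (hz.fun_pow 2) (ht.fun_pow 2), horizGrad_pow hz, horizGrad_pow ht,
    horizGrad_vertical, horizGrad_norm_horiz_sq, koranyiField]
  module

theorem differentiableAt_koranyiNorm (hq : q ≠ 0) : DifferentiableAt ℝ koranyiNorm q :=
  (contDiffAt_koranyiNorm hq (n := 1)).differentiableAt one_ne_zero

theorem horizGrad_koranyiNorm (hq : q ≠ 0) :
    horizGrad koranyiNorm q = (koranyiNorm q ^ 3)⁻¹ • koranyiField q := by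
  have hρ := koranyiNorm_pos hq
  have hquartic := horizGrad_koranyiNorm_pow_four q
  rw [horizGrad_pow (differentiableAt_koranyiNorm hq)] at hquartic
  refine (eq_inv_smul_iff₀ (by positivity)).2 ?_
  simpa [mul_smul] using hquartic

theorem inner_horiz_koranyiField (q : Heis m) :
    inner ℝ (horiz q) (koranyiField q) = ‖horiz q‖ ^ 4 := by
  rw [koranyiField, inner_add_right, real_inner_smul_right, real_inner_smul_right,
    real_inner_comm (rot _), inner_rot_self, real_inner_self_eq_norm_sq]
  ring

theorem norm_koranyiField (q : Heis m) : ‖koranyiField q‖ = ‖horiz q‖ * koranyiNorm q ^ 2 := by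
  refine (sq_eq_sq₀ (norm_nonneg _) (by positivity)).1 ?_
  rw [koranyiField, norm_add_sq_real, real_inner_smul_left, real_inner_smul_right, real_inner_comm,
    inner_rot_self, norm_smul, norm_smul, norm_rot, mul_pow, mul_pow, Real.norm_eq_abs, sq_abs]
  norm_num
  linear_combination -‖horiz q‖ ^ 2 * koranyiNorm_pow_four q

theorem contDiff_koranyiField {n : WithTop ℕ∞} : ContDiff ℝ n (koranyiField (m := m)) :=
  ((horiz.contDiff.norm_sq ℝ).smul horiz.contDiff).add
    (contDiff_snd.snd.smul (rot.comp horiz).contDiff)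

theorem horizDiv_koranyiField (q : Heis m) :
    horizDiv koranyiField q = (2 * m + 4) * ‖horiz q‖ ^ 2 := by
  have hz : DifferentiableAt ℝ (fun p : Heis m => ‖horiz p‖ ^ 2) q :=
    horiz.differentiableAt.norm_sq ℝ
  have ht : DifferentiableAt ℝ (fun p : Heis m => p.2.2) q := by fun_prop
  have hrot : DifferentiableAt ℝ (fun p : Heis m => rot (horiz p)) q := by fun_prop
  have hhoriz : DifferentiableAt ℝ (horiz : Heis m → HorizSpace m) q := horiz.differentiableAt
  unfold koranyiField
  rw [horizDiv_add (hz.fun_smul hhoriz) (ht.fun_smul hrot),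
    horizDiv_smul hz hhoriz, horizDiv_smul ht hrot, horizDiv_horiz, horizDiv_rot_horiz,
    horizGrad_norm_horiz_sq, horizGrad_vertical, real_inner_smul_left, real_inner_smul_left,
    real_inner_self_eq_norm_sq, real_inner_self_eq_norm_sq, norm_rot]
  ring

theorem horizGrad_norm_horiz (hq : horiz q ≠ 0) :
    horizGrad (fun p => ‖horiz p‖) q = ‖horiz q‖⁻¹ • horiz q := by
  have hnorm : DifferentiableAt ℝ (fun p : Heis m => ‖horiz p‖) q :=
    horiz.differentiableAt.norm ℝ hq
  have hsq := horizGrad_norm_horiz_sq q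
  rw [horizGrad_pow hnorm] at hsq
  refine (eq_inv_smul_iff₀ (norm_ne_zero_iff.2 hq)).2 ?_
  simpa [mul_smul] using hsq

end Gauge

section GaugeFlux

variable {q : Heis m}

theorem ne_zero_of_horiz_ne_zero (hq : horiz q ≠ 0) : q ≠ 0 := by
  rintro rfl
  exact hq (map_zero _)

theorem differentiableAt_norm_horiz (hq : horiz q ≠ 0) :
    DifferentiableAt ℝ (fun p : Heis m => ‖horiz p‖) q :=
  horiz.differentiableAt.norm ℝ hq

theorem inner_horizGrad_norm_horiz_koranyiField (hq : horiz q ≠ 0) :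
    inner ℝ (horizGrad (fun p => ‖horiz p‖) q) (koranyiField q) = ‖horiz q‖ ^ 3 := by
  have hz : ‖horiz q‖ ≠ 0 := norm_ne_zero_iff.2 hq
  rw [horizGrad_norm_horiz hq, real_inner_smul_left, inner_horiz_koranyiField]
  field_simp

theorem inner_horizGrad_koranyiNorm_koranyiField (hq : q ≠ 0) :
    inner ℝ (horizGrad koranyiNorm q) (koranyiField q) = ‖horiz q‖ ^ 2 * koranyiNorm q := by
  have hρ := (koranyiNorm_pos hq).ne'
  rw [horizGrad_koranyiNorm hq, real_inner_smul_left, real_inner_self_eq_norm_sq, norm_koranyiField]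
  field_simp

theorem inner_horizGrad_norm_horiz_div_koranyiNorm (hq : horiz q ≠ 0) :
    inner ℝ (horizGrad (fun p => ‖horiz p‖ / koranyiNorm p) q) (koranyiField q) = 0 := by
  have hq' := ne_zero_of_horiz_ne_zero hq
  have hρ := (koranyiNorm_pos hq').ne'
  have hρ_diff := differentiableAt_koranyiNorm hq'
  simp only [div_eq_mul_inv]
  rw [horizGrad_mul (differentiableAt_norm_horiz hq) (hρ_diff.fun_inv hρ), horizGrad_inv hρ_diff hρ,
    inner_add_left, real_inner_smul_left, real_inner_smul_left, real_inner_smul_left,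
    inner_horizGrad_norm_horiz_koranyiField hq, inner_horizGrad_koranyiNorm_koranyiField hq']
  field_simp
  ring

theorem differentiableAt_inv_norm_horiz_mul_koranyiNorm_sq (hq : horiz q ≠ 0) :
    DifferentiableAt ℝ (fun p => (‖horiz p‖ * koranyiNorm p ^ 2)⁻¹) q :=
  have hq' := ne_zero_of_horiz_ne_zero hq
  ((differentiableAt_norm_horiz hq).fun_mul ((differentiableAt_koranyiNorm hq').fun_pow 2)).fun_inv
    (mul_ne_zero (norm_ne_zero_iff.2 hq) (pow_pos (koranyiNorm_pos hq') 2).ne')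

theorem horizDiv_smul_koranyiField (hq : horiz q ≠ 0) :
    horizDiv (fun p => (‖horiz p‖ * koranyiNorm p ^ 2)⁻¹ • koranyiField p) q =
      (2 * m + 1) * ‖horiz q‖ / koranyiNorm q ^ 2 := by
  have hq' := ne_zero_of_horiz_ne_zero hq
  have hz : ‖horiz q‖ ≠ 0 := norm_ne_zero_iff.2 hq
  have hρ := (koranyiNorm_pos hq').ne'
  have hρ_diff := differentiableAt_koranyiNorm hq'
  have hz_diff := differentiableAt_norm_horiz hq
  rw [horizDiv_smul (differentiableAt_inv_norm_horiz_mul_koranyiNorm_sq hq)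
      (contDiff_koranyiField.differentiable one_ne_zero q), horizDiv_koranyiField,
    horizGrad_inv (hz_diff.fun_mul (hρ_diff.fun_pow 2)) (mul_ne_zero hz (pow_ne_zero 2 hρ)),
    horizGrad_mul hz_diff (hρ_diff.fun_pow 2), horizGrad_pow hρ_diff, real_inner_smul_left,
    inner_add_left, real_inner_smul_left, real_inner_smul_left, real_inner_smul_left,
    inner_horizGrad_norm_horiz_koranyiField hq, inner_horizGrad_koranyiNorm_koranyiField hq']
  field_simp
  norm_num
  ring

theorem horizGrad_const_mul_koranyiNorm (ε : ℝ) (hq : q ≠ 0) :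
    horizGrad (fun p => ε * koranyiNorm p) q = (ε * (koranyiNorm q ^ 3)⁻¹) • koranyiField q := by
  rw [mul_smul, ← horizGrad_koranyiNorm hq]
  simp [horizGrad, fderiv_const_mul (differentiableAt_koranyiNorm hq)]

theorem norm_horizGrad_const_mul_koranyiNorm {ε : ℝ} (hε : 0 ≤ ε) (hq : q ≠ 0) :
    ‖horizGrad (fun p => ε * koranyiNorm p) q‖ = ε * (‖horiz q‖ / koranyiNorm q) := by
  have hρ := koranyiNorm_pos hq
  rw [horizGrad_const_mul_koranyiNorm ε hq, norm_smul, norm_koranyiField,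
    Real.norm_of_nonneg (by positivity)]
  field_simp

theorem radialFlux_horizGrad_const_mul_koranyiNorm (φ : ℝ → ℝ) {ε : ℝ} (hε : 0 < ε)
    (hq : horiz q ≠ 0) :
    radialFlux φ (horizGrad (fun p => ε * koranyiNorm p) q) =
      φ (ε * (‖horiz q‖ / koranyiNorm q)) •
        (‖horiz q‖ * koranyiNorm q ^ 2)⁻¹ • koranyiField q := by
  have hq' := ne_zero_of_horiz_ne_zero hq
  have hz : ‖horiz q‖ ≠ 0 := norm_ne_zero_iff.2 hq
  have hρ := (koranyiNorm_pos hq').ne'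
  rw [radialFlux, norm_horizGrad_const_mul_koranyiNorm hε.le hq',
    horizGrad_const_mul_koranyiNorm ε hq', smul_smul, smul_smul]
  congr 1
  field_simp

theorem horizDiv_radialFlux_koranyiNorm {φ : ℝ → ℝ} {ε : ℝ} (hε : 0 < ε) (hq : horiz q ≠ 0)
    (hφ : DifferentiableAt ℝ φ (ε * (‖horiz q‖ / koranyiNorm q))) :
    horizDiv (radialFlux φ ∘ horizGrad fun p => ε * koranyiNorm p) q =
      φ (ε * (‖horiz q‖ / koranyiNorm q)) * ((2 * m + 1) * ‖horiz q‖ / koranyiNorm q ^ 2) := by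
  have hq' := ne_zero_of_horiz_ne_zero hq
  have hflux : radialFlux φ ∘ horizGrad (fun p => ε * koranyiNorm p) =ᶠ[𝓝 q] fun p =>
      φ (ε * (‖horiz p‖ / koranyiNorm p)) • (‖horiz p‖ * koranyiNorm p ^ 2)⁻¹ • koranyiField p :=
    (horiz.continuous.continuousAt.eventually_ne hq).mono fun p hp =>
      radialFlux_horizGrad_const_mul_koranyiNorm φ hε hp
  have hratio : DifferentiableAt ℝ (fun p : Heis m => ‖horiz p‖ / koranyiNorm p) q := by
    simpa only [div_eq_mul_inv] using (differentiableAt_norm_horiz hq).fun_mul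
      ((differentiableAt_koranyiNorm hq').fun_inv (koranyiNorm_pos hq').ne')
  have hcoeff : HasDerivAt (fun s => φ (ε * s)) _ (‖horiz q‖ / koranyiNorm q) :=
    hφ.hasDerivAt.comp _ ((hasDerivAt_id' _).const_mul ε)
  have hcoeff_diff : DifferentiableAt ℝ (fun p => φ (ε * (‖horiz p‖ / koranyiNorm p))) q :=
    hφ.comp q (hratio.const_mul ε)
  have hcoeff_grad : horizGrad (fun p => φ (ε * (‖horiz p‖ / koranyiNorm p))) q = _ :=
    horizGrad_comp (g := fun s => φ (ε * s)) (v := fun p => ‖horiz p‖ / koranyiNorm p) hcoeff hratio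
  have hfield : DifferentiableAt ℝ
      (fun p => (‖horiz p‖ * koranyiNorm p ^ 2)⁻¹ • koranyiField p) q :=
    (differentiableAt_inv_norm_horiz_mul_koranyiNorm_sq hq).fun_smul
      (contDiff_koranyiField.differentiable one_ne_zero q)
  rw [horizDiv_congr hflux, horizDiv_smul hcoeff_diff hfield, horizDiv_smul_koranyiField hq,
    hcoeff_grad, real_inner_smul_left, real_inner_smul_right,
    inner_horizGrad_norm_horiz_div_koranyiNorm hq, mul_zero, mul_zero, add_zero]

end GaugeFlux

section KoranyiDist

variable {h q : Heis m}

/-- The Korányi distance `ρ(h⁻¹ q)`, invariant under left translations. As a function of `q` it is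
the comparison function with pole `h`. -/
noncomputable def koranyiDist (h q : Heis m) : ℝ := koranyiNorm (mul (-h) q)

theorem koranyiDist_mul_mul (g h q : Heis m) :
    koranyiDist (mul g h) (mul g q) = koranyiDist h q := by
  rw [koranyiDist, neg_mul_mul_left, koranyiDist]

theorem koranyiDist_nonneg (h q : Heis m) : 0 ≤ koranyiDist h q :=
  koranyiNorm_nonneg _

theorem neg_mul_ne_zero (hne : q ≠ h) : mul (-h) q ≠ 0 := fun heq =>
  hne <| (mulHomeomorph (-h)).injective (heq.trans (neg_mul_cancel h).symm)

theorem koranyiDist_pos (hne : q ≠ h) : 0 < koranyiDist h q :=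
  koranyiNorm_pos (neg_mul_ne_zero hne)

theorem horiz_neg_mul (h q : Heis m) : horiz (mul (-h) q) = horiz q - horiz h := by
  rw [horiz_mul, map_neg, neg_add_eq_sub]

theorem norm_horiz_sub_le_koranyiDist (h q : Heis m) :
    ‖horiz q - horiz h‖ ≤ koranyiDist h q := by
  rw [← horiz_neg_mul]
  exact norm_horiz_le_koranyiNorm _

theorem continuous_koranyiDist (h : Heis m) : Continuous (koranyiDist h) := by
  have hnorm : Continuous (koranyiNorm (m := m)) := by
    unfold koranyiNorm
    exact Continuous.rpow_const (by fun_prop) fun _ => Or.inr (by norm_num)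
  exact hnorm.comp (mulHomeomorph (-h)).continuous

theorem contDiffAt_koranyiDist {n : WithTop ℕ∞} (hne : q ≠ h) :
    ContDiffAt ℝ n (koranyiDist h) q :=
  (contDiffAt_koranyiNorm (neg_mul_ne_zero hne)).comp q (contDiff_mul (-h)).contDiffAt

theorem tendsto_koranyiNorm_cocompact : Tendsto (koranyiNorm (m := m)) (cocompact _) atTop := by
  refine tendsto_atTop.2 fun b => ?_
  filter_upwards [tendsto_norm_cocompact_atTop.eventually_gt_atTop (b + b ^ 2)] with q hq
  by_contra! hlt
  have := koranyiNorm_nonneg q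
  nlinarith [norm_le_koranyiNorm_add_sq q]

theorem tendsto_koranyiDist_cocompact (h : Heis m) :
    Tendsto (koranyiDist h) (cocompact _) atTop :=
  tendsto_koranyiNorm_cocompact.comp (mulHomeomorph (-h)).isClosedEmbedding.tendsto_cocompact

theorem exists_pos_forall_le_koranyiDist {F : Set (Heis m)} (hF : IsClosed F) (hh : h ∉ F) :
    ∃ r > 0, ∀ q ∈ F, r ≤ koranyiDist h q := by
  obtain rfl | ⟨q₁, hq₁⟩ := F.eq_empty_or_nonempty
  · exact ⟨1, one_pos, by simp⟩
  · obtain ⟨p, hp, hmin⟩ := (continuous_koranyiDist h).continuousOn.exists_isMinOn' hF hq₁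
      (((tendsto_koranyiDist_cocompact h).eventually_ge_atTop _).filter_mono inf_le_left)
    exact ⟨_, koranyiDist_pos (ne_of_mem_of_not_mem hp hh), hmin⟩

theorem norm_horizGrad_const_mul_koranyiDist {ε : ℝ} (hε : 0 ≤ ε) (hne : q ≠ h) :
    ‖horizGrad (fun p => ε * koranyiDist h p) q‖ =
      ε * (‖horiz q - horiz h‖ / koranyiDist h q) := by
  have hcomp : (fun p => ε * koranyiDist h p) = (fun p => ε * koranyiNorm p) ∘ mul (-h) := rfl
  rw [hcomp, horizGrad_comp_mul, Function.comp_apply,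
    norm_horizGrad_const_mul_koranyiNorm hε (neg_mul_ne_zero hne), horiz_neg_mul, koranyiDist]

theorem horizDiv_radialFlux_koranyiDist {φ : ℝ → ℝ} {ε : ℝ} (hε : 0 < ε) (hne : horiz q ≠ horiz h)
    (hφ : DifferentiableAt ℝ φ (ε * (‖horiz q - horiz h‖ / koranyiDist h q))) :
    horizDiv (radialFlux φ ∘ horizGrad fun p => ε * koranyiDist h p) q =
      φ (ε * (‖horiz q - horiz h‖ / koranyiDist h q)) *
        ((2 * m + 1) * ‖horiz q - horiz h‖ / koranyiDist h q ^ 2) := by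
  have hcomp : (fun p => ε * koranyiDist h p) = (fun p => ε * koranyiNorm p) ∘ mul (-h) := rfl
  rw [hcomp, horizGrad_comp_mul, ← Function.comp_assoc, horizDiv_comp_mul, Function.comp_apply]
  rw [← sub_ne_zero] at hne
  rw [← horiz_neg_mul] at hne hφ ⊢
  exact horizDiv_radialFlux_koranyiNorm hε hne hφ

end KoranyiDist

section Poles

theorem koranyiDist_horizLift_pow_four (w : HorizSpace m) (q : Heis m) :
    koranyiDist (horizLift 0 w) q ^ 4 =
      ‖horiz q - w‖ ^ 4 + (q.2.2 - 2 * inner ℝ (rot w) (horiz q)) ^ 2 := by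
  rw [koranyiDist, koranyiNorm_pow_four, horiz_neg_mul, horiz_horizLift]
  simp [mul, sub_eq_add_neg]

theorem exists_rot_triangle (hm : 1 ≤ m) :
    ∃ z : Fin 3 → HorizSpace m, (∀ i, ‖z i‖ ≤ 2) ∧ ∀ i, inner ℝ (rot (z (i + 1))) (z i) = -1 := by
  obtain ⟨e, he⟩ : ∃ e : HorizSpace m, ‖e‖ = 1 :=
    ⟨EuclideanSpace.single (.inl ⟨0, hm⟩) 1, by simp⟩
  have hrot : inner ℝ (rot (rot e)) e = -1 := by
    rw [inner_rot_left, real_inner_self_eq_norm_sq, norm_rot, he, one_pow]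
  have hsum : ‖e + rot e‖ ≤ 2 := (norm_add_le _ _).trans (by rw [norm_rot, he]; norm_num)
  refine ⟨![e, rot e, -(e + rot e)], fun i => ?_, fun i => ?_⟩
  · fin_cases i
    · simp [he]
    · simp [he]
    · exact (norm_neg _).trans_le hsum
  · fin_cases i
    · exact hrot
    · simp [inner_add_left, he]
    · simp [inner_add_right, inner_neg_right, he]

/-- Passing to the pole `i + 1` or `i - 1` shifts the relative height `t` by `± 2 a²`, so one of the
two lowers `t²` by `4 a² |t| - 4 a⁴`, which exceeds the horizontal cost `(4 a)⁴` when
`|t| > 65 a²`. -/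
theorem exists_koranyiDist_lt_of_horiz_eq {z : Fin 3 → HorizSpace m} (hz : ∀ i, ‖z i‖ ≤ 2)
    (hz_rot : ∀ i, inner ℝ (rot (z (i + 1))) (z i) = -1) {a : ℝ} (ha : 0 < a) {q : Heis m}
    {i : Fin 3} (hq : horiz q = a • z i) (ht : 65 * a ^ 2 < |q.2.2|) :
    ∃ j, koranyiDist (horizLift 0 (a • z j)) q < koranyiDist (horizLift 0 (a • z i)) q := by
  suffices h : ∃ j, ‖a • z i - a • z j‖ ^ 4 +
      (q.2.2 - 2 * inner ℝ (rot (a • z j)) (a • z i)) ^ 2 < q.2.2 ^ 2 by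
    obtain ⟨j, hj⟩ := h
    refine ⟨j, lt_of_pow_lt_pow_left₀ 4 (koranyiDist_nonneg _ _) ?_⟩
    simpa only [koranyiDist_horizLift_pow_four, hq, sub_self, norm_zero, inner_rot_self, mul_zero,
      sub_zero, zero_pow four_ne_zero, zero_add] using hj
  have hnorm (j) : ‖a • z i - a • z j‖ ^ 4 ≤ (4 * a) ^ 4 := by
    have := norm_sub_le (z i) (z j)
    rw [← smul_sub, norm_smul, Real.norm_of_nonneg ha.le, mul_comm 4]
    gcongr
    linarith [hz i, hz j]
  have hinner (j k) : inner ℝ (rot (a • z j)) (a • z k) = a ^ 2 * inner ℝ (rot (z j)) (z k) := by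
    rw [map_smul, real_inner_smul_left, real_inner_smul_right, sq, mul_assoc]
  have hprev : inner ℝ (rot (z (i + 2))) (z i) = 1 := by
    have := hz_rot (i + 2)
    rw [show i + 2 + 1 = i by fin_cases i <;> rfl, inner_rot_left] at this
    linarith
  have ha_sq : 0 < a ^ 2 := by positivity
  rcases lt_abs.1 ht with ht | ht
  · refine ⟨i + 2, ?_⟩
    rw [hinner, hprev]
    nlinarith [hnorm (i + 2)]
  · refine ⟨i + 1, ?_⟩
    rw [hinner, hz_rot]
    nlinarith [hnorm (i + 1)]

theorem koranyiNorm_le_of_norm_horiz_le {a : ℝ} (ha : 0 ≤ a) {q : Heis m}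
    (hz : ‖horiz q‖ ≤ 2 * a) (ht : |q.2.2| ≤ 65 * a ^ 2) : koranyiNorm q ≤ 9 * a := by
  refine le_of_pow_le_pow_left₀ four_ne_zero (by positivity) ?_
  calc koranyiNorm q ^ 4 = ‖horiz q‖ ^ 4 + |q.2.2| ^ 2 := by rw [koranyiNorm_pow_four, sq_abs]
    _ ≤ (2 * a) ^ 4 + (65 * a ^ 2) ^ 2 := by gcongr
    _ ≤ (9 * a) ^ 4 := by nlinarith [pow_nonneg ha 4]

theorem exists_poles_koranyiNorm_lt (hm : 1 ≤ m) {r : ℝ} (hr : 0 < r) :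
    ∃ p : Fin 3 → Heis m, (∀ i, koranyiNorm (p i) < r) ∧ ∀ q, r ≤ koranyiNorm q →
      ∀ i, horiz q = horiz (p i) → ∃ j, koranyiDist (p j) q < koranyiDist (p i) q := by
  obtain ⟨z, hz, hz_rot⟩ := exists_rot_triangle hm
  set a := r / 10 with ha_def
  have ha : 0 < a := by positivity
  have hnorm (i) : ‖a • z i‖ ≤ 2 * a := by
    rw [norm_smul, Real.norm_of_nonneg ha.le, mul_comm]
    gcongr
    exact hz i
  refine ⟨fun i => horizLift 0 (a • z i), fun i => ?_, fun q hq i hi => ?_⟩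
  · have hheight : |(horizLift 0 (a • z i)).2.2| ≤ 65 * a ^ 2 := by
      suffices (0 : ℝ) ≤ 65 * a ^ 2 by simpa using this
      positivity
    have := koranyiNorm_le_of_norm_horiz_le ha.le (by simpa only [horiz_horizLift] using hnorm i)
      hheight
    linarith
  · rw [horiz_horizLift] at hi
    refine exists_koranyiDist_lt_of_horiz_eq hz hz_rot ha hi (lt_of_not_ge fun ht => ?_)
    linarith [koranyiNorm_le_of_norm_horiz_le ha.le (hi ▸ hnorm i) ht]

theorem exists_poles (hm : 1 ≤ m) {q₀ : Heis m} {O : Set (Heis m)} (hO : IsOpen O) (hq₀ : q₀ ∈ O) :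
    ∃ p : Fin 3 → Heis m, (∀ i, p i ∈ O) ∧ ∀ q ∉ O, ∀ i, horiz q = horiz (p i) →
      ∃ j, koranyiDist (p j) q < koranyiDist (p i) q := by
  obtain ⟨r, hr, hr_le⟩ := exists_pos_forall_le_koranyiDist hO.isClosed_compl (not_not.2 hq₀)
  obtain ⟨p, hp, hcloser⟩ := exists_poles_koranyiNorm_lt hm hr
  refine ⟨fun i => mul q₀ (p i), fun i => ?_, fun q hq i hi => ?_⟩
  · by_contra hmem
    have := hr_le _ hmem
    rw [koranyiDist, neg_mul_cancel_left] at this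
    exact this.not_gt (hp i)
  · have hdist (j) : koranyiDist (mul q₀ (p j)) q = koranyiDist (p j) (mul (-q₀) q) := by
      rw [← koranyiDist_mul_mul q₀ (p j), mul_neg_cancel_left]
    simp only [hdist]
    exact hcloser _ (hr_le q hq) i (by rw [horiz_neg_mul, hi, horiz_mul, add_sub_cancel_left])

end Poles

section Liouville

variable {φ f l : ℝ → ℝ} {u : Heis m → ℝ}

theorem IsWeakSolution.exists_mul_le_of_touching_koranyiDist (hφ : ContinuousOn φ (Ici 0))
    (hφ₁ : ContDiffOn ℝ 1 φ (Ioi 0)) (hφ0 : φ 0 = 0) (hφ_mono : MonotoneOn φ (Ici 0))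
    (hf : ContinuousOn f (Ici 0)) (hl : ContinuousOn l (Ici 0)) (hu : IsWeakSolution φ f l u)
    (hu0 : ∀ q, 0 ≤ u q) {ε : ℝ} (hε : 0 < ε) {h x : Heis m} (hx : horiz x ≠ horiz h)
    (hmax : IsLocalMax (fun q => u q - ε * koranyiDist h q) x) :
    ∃ p ∈ Ioc 0 ε, f (u x) * l p ≤ φ p * ((2 * m + 1) / koranyiDist h x) := by
  have hne : x ≠ h := fun heq => hx (congrArg _ heq)
  have hρ := koranyiDist_pos hne
  have hz : 0 < ‖horiz x - horiz h‖ := norm_pos_iff.2 (sub_ne_zero.2 hx)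
  have hzρ := norm_horiz_sub_le_koranyiDist h x
  set p := ε * (‖horiz x - horiz h‖ / koranyiDist h x) with hp
  have hp0 : 0 < p := by positivity
  have hgrad := norm_horizGrad_const_mul_koranyiDist hε.le hne
  rw [← hp] at hgrad
  have hφp : ContDiffAt ℝ 1 φ p := hφ₁.contDiffAt (Ioi_mem_nhds hp0)
  have htouch := hu.le_horizDiv_of_localMax hφ hφ_mono hφ0 hf hl hu0
    (contDiffAt_const.mul (contDiffAt_koranyiDist hne)) (hgrad ▸ hφp)
    (norm_pos_iff.1 (hgrad ▸ hp0)) hmax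
  rw [hgrad, horizDiv_radialFlux_koranyiDist hε hx (hφp.differentiableAt one_ne_zero), ← hp]
    at htouch
  have hφp0 : 0 ≤ φ p := hφ0 ▸ hφ_mono self_mem_Ici hp0.le hp0.le
  refine ⟨p, ⟨hp0, mul_le_of_le_one_right hε.le (div_le_one_of_le₀ hzρ hρ.le)⟩, htouch.trans ?_⟩
  calc φ p * ((2 * m + 1) * ‖horiz x - horiz h‖ / koranyiDist h x ^ 2)
      ≤ φ p * ((2 * m + 1) * koranyiDist h x / koranyiDist h x ^ 2) := by gcongr
    _ = φ p * ((2 * m + 1) / koranyiDist h x) := by field_simp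

theorem exists_forall_sub_koranyiDist_le (hu : Continuous u) (hu_bdd : BddAbove (range u)) {ε : ℝ}
    (hε : 0 < ε) (h : Heis m) :
    ∃ x, ∀ q, u q - ε * koranyiDist h q ≤ u x - ε * koranyiDist h x := by
  obtain ⟨M, hM⟩ := hu_bdd
  refine (hu.sub (continuous_const.mul (continuous_koranyiDist h))).exists_forall_ge ?_
  have hgrowth := (tendsto_koranyiDist_cocompact h).const_mul_atTop hε
  refine tendsto_atBot_mono (fun q => ?_) (tendsto_atBot_add_const_left _ M
    (tendsto_neg_atTop_atBot.comp hgrowth))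
  simpa [sub_eq_add_neg] using hM (mem_range_self q)

theorem exists_touching_koranyiDist (hu : Continuous u) (hu_bdd : BddAbove (range u)) {ι : Type*}
    [Finite ι] [Nonempty ι] {p : ι → Heis m} {c : ℝ}
    (hp : ∀ q, c ≤ u q → ∀ i, horiz q = horiz (p i) →
      ∃ j, koranyiDist (p j) q < koranyiDist (p i) q)
    {ε : ℝ} (hε : 0 < ε) {q₁ : Heis m} {i₁ : ι} (hc : c + ε * koranyiDist (p i₁) q₁ < u q₁) :
    ∃ i x, c ≤ u x ∧ horiz x ≠ horiz (p i) ∧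
      IsLocalMax (fun q => u q - ε * koranyiDist (p i) q) x := by
  choose x hx using fun i => exists_forall_sub_koranyiDist_le hu hu_bdd hε (p i)
  obtain ⟨i, hi⟩ := Finite.exists_max fun i => u (x i) - ε * koranyiDist (p i) (x i)
  have hcx : c ≤ u (x i) := by
    have := mul_nonneg hε.le (koranyiDist_nonneg (p i) (x i))
    linarith [hi i₁, hx i₁ q₁]
  refine ⟨i, x i, hcx, fun hhoriz => ?_, .of_forall (hx i)⟩
  obtain ⟨j, hj⟩ := hp _ hcx i hhoriz
  linarith [hi j, hx j (x i), mul_lt_mul_of_pos_left hj hε]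

theorem IsWeakSolution.le_add_mul_koranyiDist (hφ : ContinuousOn φ (Ici 0))
    (hφ₁ : ContDiffOn ℝ 1 φ (Ioi 0)) (hφ0 : φ 0 = 0) (hφ_mono : MonotoneOn φ (Ici 0))
    (hf : ContinuousOn f (Ici 0)) (hl : ContinuousOn l (Ici 0)) (hl_pos : ∀ t, 0 < t → 0 < l t)
    (hu : IsWeakSolution φ f l u) (hu0 : ∀ q, 0 ≤ u q) (hu_bdd : BddAbove (range u))
    {ι : Type*} [Finite ι] {p : ι → Heis m} {c : ℝ}
    (hp : ∀ q, c ≤ u q → ∀ i, horiz q = horiz (p i) →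
      ∃ j, koranyiDist (p j) q < koranyiDist (p i) q)
    {r : ℝ} (hr : 0 < r) (hr_le : ∀ q, c ≤ u q → ∀ i, r ≤ koranyiDist (p i) q)
    {δ : ℝ} (hδ : ∀ q, c ≤ u q → δ ≤ f (u q)) {ε : ℝ} (hε : 0 < ε)
    (hsmall : ∀ t ∈ Ioc 0 ε, φ t * ((2 * m + 1) / r) < δ * l t) (i : ι) (q : Heis m) :
    u q ≤ c + ε * koranyiDist (p i) q := by
  by_contra! hlt
  have : Nonempty ι := ⟨i⟩
  obtain ⟨j, x, hcx, hhoriz, hmax⟩ :=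
    exists_touching_koranyiDist hu.1.continuous hu_bdd hp hε hlt
  obtain ⟨t, ht, hle⟩ := hu.exists_mul_le_of_touching_koranyiDist hφ hφ₁ hφ0 hφ_mono hf hl hu0 hε
    hhoriz hmax
  have hφt : 0 ≤ φ t := hφ0 ▸ hφ_mono self_mem_Ici ht.1.le ht.1.le
  refine (hsmall t ht).not_ge ?_
  calc δ * l t ≤ f (u x) * l t := by gcongr; exacts [(hl_pos t ht.1).le, hδ x hcx]
    _ ≤ φ t * ((2 * m + 1) / koranyiDist (p j) x) := hle
    _ ≤ φ t * ((2 * m + 1) / r) := by gcongr; exact hr_le x hcx j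

theorem exists_pos_forall_le_of_continuousOn (hf : ContinuousOn f (Ici 0))
    (hf_pos : ∀ t, 0 < t → 0 < f t) (hu_bdd : BddAbove (range u)) {c : ℝ} (hc : 0 < c) :
    ∃ δ > 0, ∀ q, c ≤ u q → δ ≤ f (u q) := by
  obtain ⟨M, hM⟩ := hu_bdd
  obtain hMc | hcM := lt_or_ge M c
  · exact ⟨1, one_pos, fun q hq => absurd (hM (mem_range_self q)) (hMc.trans_le hq).not_ge⟩
  · obtain ⟨s, hs, hmin⟩ := isCompact_Icc.exists_isMinOn (nonempty_Icc.2 hcM)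
      (hf.mono fun t ht => hc.le.trans ht.1)
    exact ⟨f s, hf_pos s (hc.trans_le hs.1), fun q hq => hmin ⟨hq, hM (mem_range_self q)⟩⟩

theorem exists_pos_forall_mul_lt_of_tendsto_div (hl_pos : ∀ t, 0 < t → 0 < l t)
    (hφl : Tendsto (fun t => φ t / l t) (𝓝[>] 0) (𝓝 0)) (K : ℝ) {δ : ℝ} (hδ : 0 < δ) :
    ∃ t₀ > 0, ∀ t ∈ Ioo 0 t₀, φ t * K < δ * l t := by
  have hlim : Tendsto (fun t => φ t / l t * K) (𝓝[>] 0) (𝓝 0) := by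
    simpa using hφl.mul_const K
  obtain ⟨t₀, ht₀, hsub⟩ := mem_nhdsGT_iff_exists_Ioo_subset.1 (hlim.eventually_lt_const hδ)
  refine ⟨t₀, ht₀, fun t ht => ?_⟩
  rw [← div_lt_iff₀ (hl_pos t ht.1), ← div_mul_eq_mul_div]
  exact hsub ht

theorem IsWeakSolution.le_of_bddAbove (hm : 1 ≤ m) (hφ : ContinuousOn φ (Ici 0))
    (hφ₁ : ContDiffOn ℝ 1 φ (Ioi 0)) (hφ0 : φ 0 = 0) (hφ_mono : MonotoneOn φ (Ici 0))
    (hf : ContinuousOn f (Ici 0)) (hf_pos : ∀ t, 0 < t → 0 < f t) (hl : ContinuousOn l (Ici 0))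
    (hl_pos : ∀ t, 0 < t → 0 < l t) (hφl : Tendsto (fun t => φ t / l t) (𝓝[>] 0) (𝓝 0))
    (hu : IsWeakSolution φ f l u) (hu0 : ∀ q, 0 ≤ u q) (hu_bdd : BddAbove (range u))
    (q₁ q₀ : Heis m) : u q₁ ≤ u q₀ := by
  refine le_of_forall_gt_imp_ge_of_dense fun c hc => ?_
  have hu_cont := hu.1.continuous
  have hsublevel : IsOpen {q | u q < c} := isOpen_lt hu_cont continuous_const
  obtain ⟨p, hp_mem, hp⟩ := exists_poles hm hsublevel hc
  have hp' (q) (hq : c ≤ u q) := hp q hq.not_gt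
  obtain ⟨r, hr, hr_le⟩ : ∃ r > 0, ∀ q, c ≤ u q → ∀ i, r ≤ koranyiDist (p i) q := by
    choose r hr hr_le using fun i =>
      exists_pos_forall_le_koranyiDist hsublevel.isClosed_compl (not_not.2 (hp_mem i))
    obtain ⟨i₀, hi₀⟩ := Finite.exists_min r
    exact ⟨r i₀, hr i₀, fun q hq i => (hi₀ i).trans (hr_le i q hq.not_gt)⟩
  obtain ⟨δ, hδ, hδ_le⟩ :=
    exists_pos_forall_le_of_continuousOn hf hf_pos hu_bdd ((hu0 q₀).trans_lt hc)
  obtain ⟨t₀, ht₀, hsmall⟩ :=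
    exists_pos_forall_mul_lt_of_tendsto_div hl_pos hφl ((2 * m + 1) / r) hδ
  have hlim : Tendsto (fun ε => c + ε * koranyiDist (p 0) q₁) (𝓝[>] 0) (𝓝 c) := by
    have hcont : Continuous fun ε => c + ε * koranyiDist (p 0) q₁ := by fun_prop
    simpa using (hcont.tendsto 0).mono_left nhdsWithin_le_nhds
  refine ge_of_tendsto hlim ?_
  filter_upwards [Ioo_mem_nhdsGT ht₀] with ε hε
  exact hu.le_add_mul_koranyiDist hφ hφ₁ hφ0 hφ_mono hf hl hl_pos hu0 hu_bdd hp' hr hr_le hδ_le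
    hε.1 (fun t ht => hsmall t ⟨ht.1, ht.2.trans_lt hε.2⟩) 0 q₁

theorem IsWeakSolution.mul_le_zero_of_const {c : ℝ}
    (hu : IsWeakSolution φ f l fun _ : Heis m => c) : f c * l 0 ≤ 0 := by
  let b : ContDiffBump (0 : Heis m) := ⟨1, 2, one_pos, one_lt_two⟩
  have hb : 0 < ∫ q, b q := b.integral_pos
  have hgrad (q : Heis m) : gradNorm (fun _ => c) q = 0 := by
    rw [gradNorm_eq_norm, horizGrad_eq_zero (fderiv_const_apply c), norm_zero]
  have hweak := hu.2 b b.contDiff b.hasCompactSupport fun _ => b.nonneg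
  simp only [hgrad, inv_zero, zero_mul, integral_zero, neg_zero, integral_const_mul] at hweak
  exact nonpos_of_mul_nonpos_left hweak hb

end Liouville

end Heis

theorem CondPhi.monotoneOn {φ : ℝ → ℝ} (hφ : CondPhi φ) : MonotoneOn φ (Ici 0) :=
  (strictMonoOn_of_deriv_pos (convex_Ici 0) hφ.continuousOn fun t ht =>
    hφ.deriv_pos t (by rwa [interior_Ici] at ht)).monotoneOn

theorem mainTheorem3_general (m : ℕ) (hm : 1 ≤ m) (φ f l : ℝ → ℝ)
    (hφ : ContinuousOn φ (Ici 0)) (hφ₁ : ContDiffOn ℝ 1 φ (Ioi 0)) (hφ0 : φ 0 = 0)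
    (hφ_mono : MonotoneOn φ (Ici 0)) (hf : ContinuousOn f (Ici 0))
    (hf_pos : ∀ t, 0 < t → 0 < f t) (hl : ContinuousOn l (Ici 0)) (hl_pos : ∀ t, 0 < t → 0 < l t)
    (hφl : Tendsto (fun t => φ t / l t) (𝓝[>] 0) (𝓝 0))
    (u : Heis m → ℝ) (hu_nonneg : ∀ q, 0 ≤ u q) (hu_bdd : ∃ M : ℝ, ∀ q, u q ≤ M)
    (hu : Heis.IsWeakSolution φ f l u) :
    (∃ c : ℝ, ∀ q, u q = c) ∧ (0 < l 0 → ∀ q, u q = 0) := by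
  have hbdd : BddAbove (range u) := hu_bdd.imp fun M hM => forall_mem_range.2 hM
  have hle := hu.le_of_bddAbove hm hφ hφ₁ hφ0 hφ_mono hf hf_pos hl hl_pos hφl hu_nonneg hbdd
  obtain ⟨c, rfl⟩ : ∃ c, u = fun _ => c := ⟨u 0, funext fun q => (hle q 0).antisymm (hle 0 q)⟩
  refine ⟨⟨c, fun _ => rfl⟩, fun hl0 _ => (hu_nonneg 0).eq_of_not_lt' fun hc => ?_⟩
  exact hu.mul_le_zero_of_const.not_gt (mul_pos (hf_pos c hc) hl0)

theorem mainTheorem3 (m : ℕ) (hm : 1 ≤ m) (φ f l : ℝ → ℝ) (D Λ τ : ℝ)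
    (hD : 0 < D) (hΛ : 0 < Λ) (hτ : 0 ≤ τ)
    (hφ : CondPhi φ) (hf : CondF f) (hl : CondL l) (hφl : CondPhiL φ l)
    (hφ2 : CondPhi2 φ D τ) (hl2 : CondL2 l Λ τ)
    (u : Heis m → ℝ) (hu_nonneg : ∀ q, 0 ≤ u q) (hu_bdd : ∃ M : ℝ, ∀ q, u q ≤ M)
    (hu : Heis.IsWeakSolution φ f l u) :
    (∃ c : ℝ, ∀ q, u q = c) ∧ (0 < l 0 → ∀ q, u q = 0) :=
  mainTheorem3_general m hm φ f l hφ.continuousOn hφ.contDiffOn hφ.map_zero hφ.monotoneOn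
    hf.continuousOn hf.pos hl.continuousOn hl.pos hφl.tendsto_zero u hu_nonneg hu_bdd hu
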